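/- Let $n\ge 1$ and $k\ge 0$ be integers. Let $\Lambda^k$ be the space of complex-valued alternating $k$-linear forms on $\mathbb{R}^n$, with basis $dx_I=dx_{i_1}\wedge\dots\wedge dx_{i_k}$, $I=\{i_1<\dots<i_k\}$. Let $\mathcal{S}(\mathbb{R}^n,\Lambda^k)$ be the space of differential $k$-forms whose coefficients are (complex-valued) Schwartz functions, and let $\mathcal{S}'(\mathbb{R}^n,\Lambda^k)$ be the space of temperate currents of degree $k$, i.e. of continuous linear forms on $\mathcal{S}(\mathbb{R}^n,\Lambda^k)$. On rapidly decreasing forms put $$d=\sum_{\mu=1}^n dx_\mu\wedge\partial_\mu,\qquad \delta=-\sum_{\mu=1}^n\iota_{\partial/\partial x_\mu}\partial_\mu,\qquad \Delta=-\sum_{\mu=1}^n\partial_\mu^2,$$ with $\delta=0$ on $0$-forms, and extend these operators to currents by $\langle df,\varphi\rangle=\langle f,\delta\varphi\rangle$, $\langle\delta f,\varphi\rangle=\langle f,d\varphi\rangle$, $\langle\Delta f,\varphi\rangle=\langle f,\Delta\varphi\rangle$. Let $\mathcal{P}(\mathbb{R}^n,\Lambda^k)$ be the space of $k$-forms whose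 coefficients are complex polynomials, with $\Delta=-\sum_\mu\partial_\mu^2$ acting on the coefficients, and let $\mathcal{H}(\mathbb{R}^n,\Lambda^k)\subset\mathcal{P}(\mathbb{R}^n,\Lambda^k)$ be the subspace of the forms whose coefficients are harmonic polynomials. A form $\theta=\sum_I a_I\,dx_I\in\mathcal{P}(\mathbb{R}^n,\Lambda^k)$ is regarded as the temperate current $$\langle\theta,\varphi\rangle=\int_{\mathbb{R}^n}\theta\wedge\star\varphi=\int_{\mathbb{R}^n}\sum_I a_I(x)\,\varphi_I(x)\,dx,\qquad \varphi=\sum_I\varphi_I\,dx_I.$$ Then the sequences $$0\to\mathcal{H}(\mathbb{R}^n,\Lambda^k)\to\mathcal{P}(\mathbb{R}^n,\Lambda^k)\xrightarrow{\ \Delta\ }\mathcal{P}(\mathbb{R}^n,\Lambda^k)\to 0$$ and $$0\to\mathcal{H}(\mathbb{R}^n,\Lambda^k)\to\mathcal{S}'(\mathbb{R}^n,\Lambda^k)\xrightarrow{\ \Delta\ }\mathcal{S}'(\mathbb{R}^n,\Lambda^k)\to 0$$ are exact. In particular, every temperate current $\theta\in\mathcal{S}'(\mathbb{R}^n,\Lambda^k)$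 is the sum of an exact current (an element of $d\,\mathcal{S}'(\mathbb{R}^n,\Lambda^{k-1})$, which is $0$ for $k=0$) and a coexact current (an element of $\delta\,\mathcal{S}'(\mathbb{R}^n,\Lambda^{k+1})$). More precisely, there is $\omega\in\mathcal{S}'(\mathbb{R}^n,\Lambda^k)$ with $$\theta=\Delta\omega=\delta(d\omega)+d(\delta\omega),$$ and $\omega$ is unique up to adding an element of $\mathcal{H}(\mathbb{R}^n,\Lambda^k)$. -/

import Mathlib

open scoped SchwartzMap LineDeriv Laplacian

noncomputable section

namespace TemperateCurrents

/-- Euclidean space `ℝⁿ`. -/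
abbrev E (n : ℕ) : Type := EuclideanSpace ℝ (Fin n)

/-- The standard basis vector `∂/∂x_μ` of `ℝⁿ`. -/
def e {n : ℕ} (μ : Fin n) : E n := EuclideanSpace.single μ 1

/-- `Λᵏ`: alternating real-multilinear `k`-forms on `ℝⁿ`, with complex values. -/
def Form (n k : ℕ) : Type := E n [⋀^Fin k]→L[ℝ] ℂ

instance (n k : ℕ) : NormedAddCommGroup (Form n k) :=
  inferInstanceAs (NormedAddCommGroup (E n [⋀^Fin k]→L[ℝ] ℂ))

instance (n k : ℕ) : NormedSpace ℂ (Form n k) :=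
  inferInstanceAs (NormedSpace ℂ (E n [⋀^Fin k]→L[ℝ] ℂ))

/-- A `k`-form as a continuous alternating map. -/
def Form.toAlt {n k : ℕ} (α : Form n k) : E n [⋀^Fin k]→L[ℝ] ℂ := α

/-- A continuous alternating map as a `k`-form. -/
def Form.ofAlt {n k : ℕ} (α : E n [⋀^Fin k]→L[ℝ] ℂ) : Form n k := α

/-- The coefficient `a_I` of `dx_{i_1} ∧ ⋯ ∧ dx_{i_k}` (`I = {i_1 < ⋯ < i_k}`) of a `k`-form,
i.e. its value on `(e_{i_1}, …, e_{i_k})`. -/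
def coeff {n k : ℕ} (I : Fin k ↪o Fin n) : Form n k →L[ℂ] ℂ where
  toFun α := α.toAlt fun j => e (I j)
  map_add' _ _ := rfl
  map_smul' _ _ := rfl
  cont := (ContinuousAlternatingMap.apply ℝ (E n) ℂ fun j => e (I j)).continuous

/-- The exterior product `ε_μ α = dx_μ ∧ α`, that is
`(ε_μ α)(v_0, …, v_k) = ∑ i, (-1)^i dx_μ(v_i) α(v_0, …, v̂_i, …, v_k)`. -/
def wedge {n k : ℕ} (μ : Fin n) : Form n k →L[ℂ] Form n (k + 1) where
  toFun α := Form.ofAlt (ContinuousAlternatingMap.alternatizeUncurryFin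
    ((EuclideanSpace.proj μ : E n →L[ℝ] ℝ).smulRight α.toAlt))
  map_add' α β := by
    refine Eq.trans (congrArg ContinuousAlternatingMap.alternatizeUncurryFin ?_)
      (ContinuousAlternatingMap.alternatizeUncurryFin_add _ _)
    exact ContinuousLinearMap.ext fun v => smul_add (v μ) α.toAlt β.toAlt
  map_smul' c α := by
    refine Eq.trans (congrArg ContinuousAlternatingMap.alternatizeUncurryFin ?_)
      (ContinuousAlternatingMap.alternatizeUncurryFin_smul c _)
    exact ContinuousLinearMap.ext fun v => smul_comm (v μ) c α.toAlt
  cont := ((ContinuousAlternatingMap.alternatizeUncurryFinCLM ℝ (E n) ℂ).comp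
    (ContinuousLinearMap.smulRightL ℝ (E n) (E n [⋀^Fin k]→L[ℝ] ℂ)
      (EuclideanSpace.proj μ))).continuous

/-- The interior product `(ι_μ α)(v_1, …, v_k) = α(e_μ, v_1, …, v_k)`. -/
def interior {n k : ℕ} (μ : Fin n) : Form n (k + 1) →L[ℂ] Form n k where
  toFun α := Form.ofAlt (α.toAlt.curryLeft (e μ))
  map_add' _ _ := rfl
  map_smul' _ _ := rfl
  cont := ((ContinuousLinearMap.apply ℝ (E n [⋀^Fin k]→L[ℝ] ℂ) (e μ)).comp
    (ContinuousAlternatingMap.curryLeftLI (𝕜 := ℝ) (E := E n) (F := ℂ)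
      (n := k)).toContinuousLinearMap).continuous

/-! ### Rapidly decreasing forms -/

/-- `𝓢(ℝⁿ, Λᵏ)`: rapidly decreasing differential forms of degree `k`. -/
abbrev TestForm (n k : ℕ) : Type := 𝓢(E n, Form n k)

/-- The partial derivative `∂_μ`, acting on the coefficients of a rapidly decreasing form. -/
def testPartial {n k : ℕ} (μ : Fin n) : TestForm n k →L[ℂ] TestForm n k :=
  LineDeriv.lineDerivOpCLM ℂ (TestForm n k) (e μ)

/-- The exterior differential `d = ∑ μ, ε_μ ∘ ∂_μ` on rapidly decreasing forms. -/
def testD (n k : ℕ) : TestForm n k →L[ℂ] TestForm n (k + 1) :=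
  ∑ μ, (SchwartzMap.postcompCLM (wedge μ)).comp (testPartial μ)

/-- The codifferential `δ = -∑ μ, ι_μ ∘ ∂_μ` on rapidly decreasing forms. -/
def testDelta (n k : ℕ) : TestForm n (k + 1) →L[ℂ] TestForm n k :=
  -∑ μ, (SchwartzMap.postcompCLM (interior μ)).comp (testPartial μ)

/-- The Laplacian `Δ = -∑ μ, ∂_μ²` on rapidly decreasing forms. -/
def testLaplacian (n k : ℕ) : TestForm n k →L[ℂ] TestForm n k :=
  -∑ μ, (testPartial μ).comp (testPartial μ)

/-! ### Temperate currents -/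

/-- `𝓢'(ℝⁿ, Λᵏ)`: temperate currents of degree `k`, i.e. continuous linear forms on
`𝓢(ℝⁿ, Λᵏ)`, with the weak-* topology. -/
abbrev Current (n k : ℕ) : Type := TestForm n k →Lₚₜ[ℂ] ℂ

/-- The exterior differential of currents: `⟨d f, φ⟩ = ⟨f, δ φ⟩`. -/
def d (n k : ℕ) : Current n k →L[ℂ] Current n (k + 1) :=
  PointwiseConvergenceCLM.precomp ℂ (testDelta n k)

/-- The codifferential of currents of positive degree: `⟨δ f, φ⟩ = ⟨f, d φ⟩`. -/
def delta (n k : ℕ) : Current n (k + 1) →L[ℂ] Current n k :=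
  PointwiseConvergenceCLM.precomp ℂ (testD n k)

/-- The Laplacian of currents: `⟨Δ f, φ⟩ = ⟨f, Δ φ⟩`. -/
def laplacian (n k : ℕ) : Current n k →L[ℂ] Current n k :=
  PointwiseConvergenceCLM.precomp ℂ (testLaplacian n k)

/-- The operator `ω ↦ d (δ ω)` in degree `k`. It is zero in degree `0`, since `δ` maps
`0`-currents to currents of degree `-1`, which are zero. -/
def dDelta (n : ℕ) : (k : ℕ) → Current n k →L[ℂ] Current n k
  | 0 => 0
  | k + 1 => (d n k).comp (delta n k)

/-- The operator `ω ↦ δ (d ω)` in degree `k`. -/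
def deltaD (n k : ℕ) : Current n k →L[ℂ] Current n k :=
  (delta n k).comp (d n k)

/-- The exact currents of degree `k`: the image of `d` (zero in degree `0`). -/
def exactCurrents (n : ℕ) : (k : ℕ) → Submodule ℂ (Current n k)
  | 0 => ⊥
  | k + 1 => LinearMap.range (d n k).toLinearMap

/-- The coexact currents of degree `k`: the image of `δ`. -/
def coexactCurrents (n k : ℕ) : Submodule ℂ (Current n k) :=
  LinearMap.range (delta n k).toLinearMap

/-! ### Polynomial forms -/

/-- The polynomial function `ℝⁿ → ℂ` given by a polynomial with complex coefficients. -/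
def polyFun {n : ℕ} (p : MvPolynomial (Fin n) ℂ) (x : E n) : ℂ :=
  MvPolynomial.eval (fun i => (x i : ℂ)) p

/-- `𝓟(ℝⁿ, Λᵏ)`: differential forms of degree `k` all of whose coefficients are polynomials. -/
def polyForms (n k : ℕ) : Submodule ℂ (E n → Form n k) where
  carrier := {θ | ∀ I : Fin k ↪o Fin n, ∃ p : MvPolynomial (Fin n) ℂ,
    ∀ x, coeff I (θ x) = polyFun p x}
  zero_mem' I := ⟨0, fun x => by simp [polyFun]⟩
  add_mem' {θ η} hθ hη I := by
    obtain ⟨p, hp⟩ := hθ I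
    obtain ⟨q, hq⟩ := hη I
    exact ⟨p + q, fun x => by simp [polyFun, hp x, hq x]⟩
  smul_mem' c θ hθ I := by
    obtain ⟨p, hp⟩ := hθ I
    exact ⟨MvPolynomial.C c * p, fun x => by simp [polyFun, hp x]⟩

/-- `𝓗(ℝⁿ, Λᵏ)`: differential forms of degree `k` all of whose coefficients are harmonic
polynomials, i.e. polynomials `p` with `∑ i, ∂_i² p = 0`. -/
def harmonicForms (n k : ℕ) : Submodule ℂ (E n → Form n k) where
  carrier := {θ | ∀ I : Fin k ↪o Fin n, ∃ p : MvPolynomial (Fin n) ℂ,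
    ∑ i, MvPolynomial.pderiv i (MvPolynomial.pderiv i p) = 0 ∧
    ∀ x, coeff I (θ x) = polyFun p x}
  zero_mem' I := ⟨0, by simp, fun x => by simp [polyFun]⟩
  add_mem' {θ η} hθ hη I := by
    obtain ⟨p, hp0, hp⟩ := hθ I
    obtain ⟨q, hq0, hq⟩ := hη I
    exact ⟨p + q, by simp [Finset.sum_add_distrib, hp0, hq0],
      fun x => by simp [polyFun, hp x, hq x]⟩
  smul_mem' c θ hθ I := by
    obtain ⟨p, hp0, hp⟩ := hθ I
    refine ⟨MvPolynomial.C c * p, ?_, fun x => by simp [polyFun, hp x]⟩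
    rw [← MvPolynomial.smul_eq_C_mul]
    simp only [Derivation.map_smul, ← Finset.smul_sum, hp0, smul_zero]

lemma harmonicForms_le (n k : ℕ) : harmonicForms n k ≤ polyForms n k := by
  intro θ hθ I
  obtain ⟨p, -, hp⟩ := hθ I
  exact ⟨p, hp⟩

/-- The inclusion `𝓗(ℝⁿ, Λᵏ) → 𝓟(ℝⁿ, Λᵏ)`. -/
def harmonicToPoly (n k : ℕ) : harmonicForms n k →ₗ[ℂ] polyForms n k :=
  Submodule.inclusion (harmonicForms_le n k)

lemma polyFun_hasTemperateGrowth {n : ℕ} (p : MvPolynomial (Fin n) ℂ) :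
    (polyFun p).HasTemperateGrowth := by
  induction p using MvPolynomial.induction_on with
  | C a =>
    have : polyFun (n := n) (MvPolynomial.C a) = fun _ => a := by ext; simp [polyFun]
    rw [this]; exact .const a
  | add p q hp hq =>
    have : polyFun (p + q) = polyFun p + polyFun q := by ext; simp [polyFun]
    rw [this]; exact hp.add hq
  | mul_X p i hp =>
    have : polyFun (p * MvPolynomial.X i) = polyFun p *
        ⇑(Complex.ofRealCLM.comp (EuclideanSpace.proj i : E n →L[ℝ] ℝ)) := by
      ext; simp [polyFun]
    rw [this]
    exact hp.mul (ContinuousLinearMap.hasTemperateGrowth _)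

lemma polyFun_contDiff {n : ℕ} (p : MvPolynomial (Fin n) ℂ) (m : ℕ∞) :
    ContDiff ℝ m (polyFun p) :=
  (polyFun_hasTemperateGrowth p).1.of_le (mod_cast le_top)

lemma form_ext {n k : ℕ} {α β : Form n k} (h : ∀ I : Fin k ↪o Fin n, coeff I α = coeff I β) :
    α = β := by
  suffices α.toAlt.toAlternatingMap = β.toAlt.toAlternatingMap from
    ContinuousAlternatingMap.toAlternatingMap_injective this
  refine Module.Basis.ext_alternating (EuclideanSpace.basisFun (Fin n) ℝ).toBasis fun v hv => ?_
  have hs : StrictMono (v ∘ Tuple.sort v) :=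
    (Tuple.monotone_sort v).strictMono_of_injective (hv.comp (Equiv.injective _))
  have key := h (OrderEmbedding.ofStrictMono _ hs)
  have h1 : ∀ γ : Form n k, coeff (OrderEmbedding.ofStrictMono _ hs) γ =
      γ.toAlt.toAlternatingMap ((fun j => e (v j)) ∘ Tuple.sort v) := fun γ => rfl
  rw [h1, h1, AlternatingMap.map_perm, AlternatingMap.map_perm] at key
  have h2 : (fun i => (EuclideanSpace.basisFun (Fin n) ℝ).toBasis (v i)) = fun j => e (v j) := by
    ext; simp [e]
  rw [h2]
  exact smul_left_cancel _ key

/-- A form is the sum of its coefficients times fixed forms. -/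
lemma exists_dual (n k : ℕ) : ∃ b : (Fin k ↪o Fin n) → Form n k,
    ∀ α : Form n k, α = ∑ I, coeff I α • b I := by
  let c : Form n k →ₗ[ℂ] ((Fin k ↪o Fin n) → ℂ) := LinearMap.pi fun I => (coeff I).toLinearMap
  have hc : LinearMap.ker c = ⊥ := LinearMap.ker_eq_bot.2 fun α β h =>
    form_ext fun I => congrFun h I
  obtain ⟨L, hL⟩ := LinearMap.exists_leftInverse_of_injective c hc
  refine ⟨fun I => L (Pi.single I 1), fun α => ?_⟩
  have h1 : L (c α) = α := LinearMap.congr_fun hL α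
  conv_lhs => rw [← h1, pi_eq_sum_univ' (c α), map_sum]
  refine Finset.sum_congr rfl fun I _ => ?_
  rw [map_smul]
  rfl

lemma polyForms_hasTemperateGrowth {n k : ℕ} (θ : polyForms n k) :
    (θ : E n → Form n k).HasTemperateGrowth := by
  obtain ⟨b, hb⟩ := exists_dual n k
  choose p hp using θ.2
  have : (θ : E n → Form n k) = fun x => ∑ I, polyFun (p I) x • b I := by
    ext1 x
    rw [hb (θ.1 x)]
    exact Finset.sum_congr rfl fun I _ => by rw [hp]
  rw [this]
  exact .sum fun I _ => (polyFun_hasTemperateGrowth (p I)).smul (.const (b I))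

lemma polyForms_contDiff {n k : ℕ} (θ : polyForms n k) (m : ℕ∞) :
    ContDiff ℝ m (θ : E n → Form n k) :=
  (polyForms_hasTemperateGrowth θ).1.of_le (mod_cast le_top)

lemma polyFun_hasFDerivAt {n : ℕ} (p : MvPolynomial (Fin n) ℂ) (x : E n) :
    HasFDerivAt (polyFun p) (∑ i, polyFun (MvPolynomial.pderiv i p) x •
      Complex.ofRealCLM.comp (EuclideanSpace.proj i : E n →L[ℝ] ℝ)) x := by
  induction p using MvPolynomial.induction_on with
  | C a =>
    have : polyFun (n := n) (MvPolynomial.C a) = fun _ => a := by ext; simp [polyFun]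
    rw [this]
    exact (hasFDerivAt_const a x).congr_fderiv (by ext v; simp [polyFun])
  | add p q hp hq =>
    have : polyFun (p + q) = polyFun p + polyFun q := by ext; simp [polyFun]
    rw [this]
    refine (hp.add hq).congr_fderiv ?_
    rw [← Finset.sum_add_distrib]
    exact Finset.sum_congr rfl fun i _ => by rw [← add_smul]; simp [polyFun]
  | mul_X p j hp =>
    have : polyFun (p * MvPolynomial.X j) = fun y => polyFun p y *
        (Complex.ofRealCLM.comp (EuclideanSpace.proj j : E n →L[ℝ] ℝ)) y := by
      ext; simp [polyFun]
    rw [this]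
    refine (hp.mul (ContinuousLinearMap.hasFDerivAt
      (Complex.ofRealCLM.comp (EuclideanSpace.proj j : E n →L[ℝ] ℝ)))).congr_fderiv ?_
    ext v
    simp only [polyFun, Derivation.leibniz, MvPolynomial.pderiv_X]
    simp [add_mul, Finset.sum_add_distrib, Finset.mul_sum, mul_assoc, Pi.single_apply, apply_ite,
      ite_mul]

lemma polyFun_laplacian {n : ℕ} (p : MvPolynomial (Fin n) ℂ) :
    Δ (polyFun p) = polyFun (∑ i, MvPolynomial.pderiv i (MvPolynomial.pderiv i p)) := by
  have h1 : ∀ q : MvPolynomial (Fin n) ℂ, ∀ j : Fin n, ∀ x : E n,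
      fderiv ℝ (polyFun q) x (e j) = polyFun (MvPolynomial.pderiv j q) x := by
    intro q j x
    rw [(polyFun_hasFDerivAt q x).fderiv]
    simp [e, apply_ite]
  rw [InnerProductSpace.laplacian_eq_iteratedFDeriv_orthonormalBasis _
    (EuclideanSpace.basisFun (Fin n) ℝ)]
  ext x
  have hp : ContDiff ℝ 2 (polyFun p) := polyFun_contDiff p 2
  have h2 : DifferentiableAt ℝ (fderiv ℝ (polyFun p)) x :=
    (hp.fderiv_right (m := 1) (by norm_num)).differentiable one_ne_zero x
  have h3 : polyFun (∑ i, MvPolynomial.pderiv i (MvPolynomial.pderiv i p)) x =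
      ∑ i, polyFun (MvPolynomial.pderiv i (MvPolynomial.pderiv i p)) x := by
    simp [polyFun]
  rw [h3]
  refine Finset.sum_congr rfl fun i _ => ?_
  rw [iteratedFDeriv_two_apply, ← h1 _ i x]
  have h4 : polyFun (MvPolynomial.pderiv i p) = fun y => fderiv ℝ (polyFun p) y (e i) := by
    ext y; rw [h1]
  rw [h4, fderiv_clm_apply h2 (by fun_prop)]
  simp [e]

/-- The Laplacian `Δ θ = -∑ μ, ∂_μ² θ` on `𝓟(ℝⁿ, Λᵏ)`. (The Laplacian in Mathlib is `∑ μ, ∂_μ²`,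
hence the sign.) -/
def polyLaplacian (n k : ℕ) : polyForms n k →ₗ[ℂ] polyForms n k where
  toFun θ := ⟨-Δ (θ : E n → Form n k), fun I => by
    obtain ⟨p, hp⟩ := θ.2 I
    refine ⟨-∑ i, MvPolynomial.pderiv i (MvPolynomial.pderiv i p), fun x => ?_⟩
    have h := (polyForms_contDiff θ 2).contDiffAt (x := x) |>.laplacian_CLM_comp_left
      (l := (coeff I).restrictScalars ℝ)
    have h' : ((coeff I).restrictScalars ℝ : Form n k → ℂ) ∘ (θ : E n → Form n k) = polyFun p :=
      funext hp
    rw [h', polyFun_laplacian] at h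
    have h'' : polyFun (-∑ i, MvPolynomial.pderiv i (MvPolynomial.pderiv i p)) x =
      -polyFun (∑ i, MvPolynomial.pderiv i (MvPolynomial.pderiv i p)) x := by simp [polyFun]
    rw [h'', h, Pi.neg_apply, map_neg]
    rfl⟩
  map_add' θ η := by
    ext1
    funext x
    have h := ((polyForms_contDiff θ 2).contDiffAt (x := x)).laplacian_add
      ((polyForms_contDiff η 2).contDiffAt (x := x))
    change -(Δ ((θ : E n → Form n k) + (η : E n → Form n k))) x = _
    rw [h, neg_add]
    rfl
  map_smul' c θ := by
    ext1
    funext x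
    have h := ((polyForms_contDiff θ 2).contDiffAt (x := x)).laplacian_CLM_comp_left
      (l := (c • ContinuousLinearMap.id ℂ (Form n k)).restrictScalars ℝ)
    exact (congrArg Neg.neg h).trans (smul_neg c _).symm

/-- The pointwise bilinear pairing with `α ∧ ⋆β = (α, β) dx_1 ∧ ⋯ ∧ dx_n`; the forms
`dx_{i_1} ∧ ⋯ ∧ dx_{i_k}`, `i_1 < ⋯ < i_k`, are orthonormal for it. -/
def pairing (n k : ℕ) : Form n k →L[ℂ] Form n k →L[ℂ] ℂ :=
  ∑ I : Fin k ↪o Fin n, (ContinuousLinearMap.mul ℂ ℂ).bilinearComp (coeff I) (coeff I)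

lemma pairing_apply {n k : ℕ} (α β : Form n k) :
    pairing n k α β = ∑ I, coeff I α * coeff I β := by
  simp [pairing]

/-- The rapidly decreasing function `x ↦ (θ(x), φ(x))`, depending continuously on the rapidly
decreasing form `φ`, for `θ` a polynomial form. -/
def polyPairing {n k : ℕ} (θ : polyForms n k) : TestForm n k →L[ℂ] 𝓢(E n, ℂ) :=
  SchwartzMap.bilinLeftCLM (pairing n k).flip (polyForms_hasTemperateGrowth θ)

lemma polyPairing_apply {n k : ℕ} (θ : polyForms n k) (φ : TestForm n k) (x : E n) :
    polyPairing θ φ x = ∑ I, coeff I (θ.1 x) * coeff I (φ x) :=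
  pairing_apply (θ.1 x) (φ x)

lemma polyPairing_add {n k : ℕ} (θ η : polyForms n k) :
    polyPairing (θ + η) = polyPairing θ + polyPairing η := by
  ext φ x
  have h : (polyPairing θ + polyPairing η) φ x = polyPairing θ φ x + polyPairing η φ x := rfl
  rw [h, polyPairing_apply, polyPairing_apply, polyPairing_apply, ← Finset.sum_add_distrib]
  refine Finset.sum_congr rfl fun I _ => ?_
  rw [← add_mul, ← map_add]
  rfl

lemma polyPairing_smul {n k : ℕ} (c : ℂ) (θ : polyForms n k) :
    polyPairing (c • θ) = c • polyPairing θ := by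
  ext φ x
  have h : (c • polyPairing θ) φ x = c * polyPairing θ φ x := rfl
  rw [h, polyPairing_apply, polyPairing_apply, Finset.mul_sum]
  refine Finset.sum_congr rfl fun I _ => ?_
  rw [← mul_assoc, ← smul_eq_mul c, ← map_smul]
  rfl

/-- The current `⟨θ, φ⟩ = ∫ θ ∧ ⋆φ` defined by a polynomial form `θ`. -/
def polyToCurrent (n k : ℕ) : polyForms n k →ₗ[ℂ] Current n k where
  toFun θ := ContinuousLinearMap.toPointwiseConvergenceCLM _ _ _ _
    ((SchwartzMap.integralCLM ℂ MeasureTheory.volume).comp (polyPairing θ))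
  map_add' θ η := by
    rw [polyPairing_add, ContinuousLinearMap.comp_add, map_add]
  map_smul' c θ := by
    rw [polyPairing_smul, ContinuousLinearMap.comp_smul, map_smul, RingHom.id_apply]

lemma polyToCurrent_apply {n k : ℕ} (θ : polyForms n k) (φ : TestForm n k) :
    polyToCurrent n k θ φ = ∫ x, ∑ I : Fin k ↪o Fin n, coeff I (θ.1 x) * coeff I (φ x) := by
  simp_rw [← polyPairing_apply]
  rfl

/-- The map `𝓗(ℝⁿ, Λᵏ) → 𝓢'(ℝⁿ, Λᵏ)`. -/
def harmonicToCurrent (n k : ℕ) : harmonicForms n k →ₗ[ℂ] Current n k :=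
  (polyToCurrent n k).comp (harmonicToPoly n k)

end TemperateCurrents

end

/-! The Fourier transform turns `Δ` into multiplication by `4π²|x|²`, so both the kernel and the
range of `Δ` on currents are questions about multiplying and dividing functionals by `|x|²`, whose
only zero is the origin.

The multipliers `(c² + |x|²)⁻¹` approximate division as `c → 0`. On functions vanishing to high
enough order at the origin they are bounded uniformly in `c` (`exists_seminorm_resolventCLM_le`).
Letting `c → 0` gives two facts. A functional killed by `|x|²` vanishes on such functions
(`exists_vanishing_le_ker`). For any functional `T`, a bound `‖T φ‖ ≤ q (|x|² φ)` holds on them, so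
Hahn–Banach yields `W` with `T φ = W (|x|² φ)` there (`exists_division`).

A linear form that vanishes on these functions is a finite combination of derivatives of evaluation
at `0`, and its Fourier transform is a polynomial form (`mem_fourierPolyForms_of_vanishing`). Hence
`Δω = 0` forces `ω` to be polynomial, and every current is in the range of `Δ` up to a polynomial
error. That error is removed because `Δ` is onto on polynomials, by an elementary induction on
monomials (`monomial_mem_range_mvLaplacian`).

The Hodge decomposition is then `Δ = δd + dδ`, which follows from the anticommutation of interior
and exterior products (`interior_wedge_add_wedge_interior`) and the commutation of partial
derivatives. -/

open scoped FourierTransform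

noncomputable section

namespace TemperateCurrents

/-! ### Multiplication operators on Schwartz functions and their commutators with derivatives. -/

section Multipliers

variable {n : ℕ} (F : Type*) [NormedAddCommGroup F] [NormedSpace ℂ F]

/-- The partial derivative `∂_i` of Schwartz functions with values in `F`. -/
def partialCLM (i : Fin n) : 𝓢(E n, F) →L[ℂ] 𝓢(E n, F) :=
  LineDeriv.lineDerivOpCLM ℂ 𝓢(E n, F) (e i)

/-- The function `x ↦ (c² + |x|²)⁻¹`. -/
def resolvent (c : ℝ) (x : E n) : ℂ := (((c ^ 2 + ‖x‖ ^ 2)⁻¹ : ℝ) : ℂ)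

/-- Multiplication by `(c² + |x|²)⁻ʲ`. -/
def resolventCLM (c : ℝ) (j : ℕ) : 𝓢(E n, F) →L[ℂ] 𝓢(E n, F) :=
  SchwartzMap.smulLeftCLM F fun x => resolvent c x ^ j

/-- Multiplication by the coordinate `x_i`. -/
def coordCLM (i : Fin n) : 𝓢(E n, F) →L[ℂ] 𝓢(E n, F) :=
  SchwartzMap.smulLeftCLM F fun x => ((x i : ℝ) : ℂ)

/-- Multiplication by `|x|²`. -/
def normSqCLM (n : ℕ) : 𝓢(E n, F) →L[ℂ] 𝓢(E n, F) :=
  SchwartzMap.smulLeftCLM F fun x => ((‖x‖ ^ 2 : ℝ) : ℂ)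

variable {F}

lemma coord_hasTemperateGrowth (i : Fin n) :
    (fun x : E n => ((x i : ℝ) : ℂ)).HasTemperateGrowth :=
  (Complex.ofRealCLM.comp (EuclideanSpace.proj i : E n →L[ℝ] ℝ)).hasTemperateGrowth

lemma normSq_hasTemperateGrowth :
    (fun x : E n => ((‖x‖ ^ 2 : ℝ) : ℂ)).HasTemperateGrowth :=
  Complex.ofRealCLM.hasTemperateGrowth.comp (Function.hasTemperateGrowth_norm_sq (E n))

/-- Scaling: `(c² + |x|²)⁻¹ = c⁻² (1 + |x/c|²)⁻¹`, which reduces to the case `c = 1`. -/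
lemma resolvent_hasTemperateGrowth {c : ℝ} (hc : 0 < c) :
    (resolvent (n := n) c).HasTemperateGrowth := by
  have h := (Function.hasTemperateGrowth_one_add_norm_sq_rpow (E n) (-1)).comp
    (c⁻¹ • ContinuousLinearMap.id ℝ (E n)).hasTemperateGrowth
  have h' := (Function.HasTemperateGrowth.const (E := E n) ((c ^ 2)⁻¹ : ℝ)).mul h
  convert Complex.ofRealCLM.hasTemperateGrowth.comp h' using 1
  ext x
  simp only [resolvent, Function.comp_apply, Pi.mul_apply, Complex.ofRealCLM_apply]
  congr 1
  rw [Real.rpow_neg_one, ← mul_inv]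
  congr 1
  simp [norm_smul, mul_pow, mul_add]
  field_simp

lemma resolvent_pow_hasTemperateGrowth {c : ℝ} (hc : 0 < c) (j : ℕ) :
    (fun x : E n => resolvent c x ^ j).HasTemperateGrowth :=
  (resolvent_hasTemperateGrowth hc).pow j

lemma coordCLM_apply (i : Fin n) (φ : 𝓢(E n, F)) (x : E n) :
    coordCLM F i φ x = ((x i : ℝ) : ℂ) • φ x :=
  SchwartzMap.smulLeftCLM_apply_apply (coord_hasTemperateGrowth i) φ x

lemma normSqCLM_apply (φ : 𝓢(E n, F)) (x : E n) :
    normSqCLM F n φ x = ((‖x‖ ^ 2 : ℝ) : ℂ) • φ x :=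
  SchwartzMap.smulLeftCLM_apply_apply normSq_hasTemperateGrowth φ x

lemma resolventCLM_apply {c : ℝ} (hc : 0 < c) (j : ℕ) (φ : 𝓢(E n, F)) (x : E n) :
    resolventCLM F c j φ x = resolvent c x ^ j • φ x :=
  SchwartzMap.smulLeftCLM_apply_apply (resolvent_pow_hasTemperateGrowth hc j) φ x

lemma partialCLM_apply (i : Fin n) (φ : 𝓢(E n, F)) (x : E n) :
    partialCLM F i φ x = fderiv ℝ φ x (e i) := rfl

lemma partialCLM_coordCLM (i j : Fin n) (φ : 𝓢(E n, F)) :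
    partialCLM F i (coordCLM F j φ) =
      coordCLM F j (partialCLM F i φ) + (if i = j then (1 : ℂ) else 0) • φ := by
  ext x
  have h1 : HasFDerivAt (fun y : E n => ((y j : ℝ) : ℂ) • φ y) _ x :=
    (ContinuousLinearMap.hasFDerivAt
      (Complex.ofRealCLM.comp (EuclideanSpace.proj j : E n →L[ℝ] ℝ))).smul
      (φ.hasFDerivAt x)
  have h2 : (coordCLM F j φ : E n → F) = fun y => ((y j : ℝ) : ℂ) • φ y :=
    funext fun y => coordCLM_apply j φ y
  rw [partialCLM_apply, h2, h1.fderiv]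
  change _ = coordCLM F j (partialCLM F i φ) x + (if i = j then (1 : ℂ) else 0) • φ x
  rw [coordCLM_apply, partialCLM_apply]
  by_cases h : i = j
  · subst h; simp [e]
  · simp [e, h, Ne.symm h]

lemma resolvent_hasFDerivAt {c : ℝ} (hc : 0 < c) (x : E n) :
    HasFDerivAt (fun y : E n => (c ^ 2 + ‖y‖ ^ 2)⁻¹)
      ((-((c ^ 2 + ‖x‖ ^ 2) ^ 2)⁻¹ * 2) • innerSL ℝ x) x := by
  have h1 : HasFDerivAt (fun y : E n => c ^ 2 + ‖y‖ ^ 2) ((2 : ℝ) • innerSL ℝ x) x := by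
    simpa [ofNat_smul_eq_nsmul] using
      (hasStrictFDerivAt_norm_sq x).hasFDerivAt.const_add (c ^ 2)
  have h2 := (hasDerivAt_inv (x := c ^ 2 + ‖x‖ ^ 2) (by positivity)).comp_hasFDerivAt x h1
  rw [smul_smul] at h2
  exact h2

/-- In the last term the extra resolvent factor costs two orders of vanishing at the origin and
`x_i` gives one back, so each derivative costs one order in total. -/
lemma partialCLM_resolventCLM {c : ℝ} (hc : 0 < c) (i : Fin n) (j : ℕ) (φ : 𝓢(E n, F)) :
    partialCLM F i (resolventCLM F c j φ) = resolventCLM F c j (partialCLM F i φ) -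
      (2 * j : ℂ) • resolventCLM F c (j + 1) (coordCLM F i φ) := by
  ext x
  have h0 : HasFDerivAt (resolvent c) _ x :=
    (Complex.ofRealCLM.hasFDerivAt.comp x (resolvent_hasFDerivAt hc x) :)
  have h1 : HasFDerivAt (fun y : E n => resolvent c y ^ j • φ y) _ x :=
    (h0.pow j).smul (φ.hasFDerivAt x)
  have h2 : (resolventCLM F c j φ : E n → F) = fun y => resolvent c y ^ j • φ y :=
    funext fun y => resolventCLM_apply hc j φ y
  rw [partialCLM_apply, h2, h1.fderiv]
  change _ = resolventCLM F c j (partialCLM F i φ) x -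
      (2 * j : ℂ) • resolventCLM F c (j + 1) (coordCLM F i φ) x
  rw [resolventCLM_apply hc, resolventCLM_apply hc, partialCLM_apply, coordCLM_apply]
  have h3 : inner ℝ x (e i) = x i := by simp [e, EuclideanSpace.inner_single_right]
  simp only [add_apply, smul_apply,
    ContinuousLinearMap.smulRight_apply, ContinuousLinearMap.comp_apply, innerSL_apply_apply, h3,
    Complex.ofRealCLM_apply, smul_eq_mul, sub_eq_add_neg]
  rw [← neg_smul, smul_smul, smul_smul]
  congr 2
  -- The derivative of a power carries the exponent `j - 1`, truncated at `j = 0`.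
  rcases j with _ | j
  · simp
  · simp only [resolvent, Nat.add_sub_cancel, ← inv_pow]
    push_cast
    simp only [nsmul_eq_mul]
    push_cast
    ring

end Multipliers

/-! ### Vanishing at the origin, and division of functionals by `|x|²`. -/

section Division

variable {n : ℕ} {F : Type*} [NormedAddCommGroup F] [NormedSpace ℂ F]

/-- Evaluation of Schwartz functions at the origin. -/
def evalZero (n : ℕ) (F : Type*) [NormedAddCommGroup F] [NormedSpace ℂ F] :
    𝓢(E n, F) →ₗ[ℂ] F where
  toFun φ := φ 0
  map_add' _ _ := rfl
  map_smul' _ _ := rfl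

/-- The Schwartz functions all of whose derivatives of order less than `s` vanish at the origin. -/
def vanishing (n : ℕ) (F : Type*) [NormedAddCommGroup F] [NormedSpace ℂ F] :
    ℕ → Submodule ℂ 𝓢(E n, F)
  | 0 => ⊤
  | s + 1 => LinearMap.ker (evalZero n F) ⊓
      ⨅ i, (vanishing n F s).comap (partialCLM F i).toLinearMap

lemma mem_vanishing_succ {s : ℕ} {φ : 𝓢(E n, F)} :
    φ ∈ vanishing n F (s + 1) ↔ φ 0 = 0 ∧ ∀ i, partialCLM F i φ ∈ vanishing n F s := by
  simp only [vanishing, Submodule.mem_inf, Submodule.mem_iInf]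
  rfl

lemma vanishing_succ_le (s : ℕ) : vanishing n F (s + 1) ≤ vanishing n F s := by
  induction s with
  | zero => exact le_top
  | succ s ih =>
    intro φ hφ
    rw [mem_vanishing_succ] at hφ ⊢
    exact ⟨hφ.1, fun i => ih (hφ.2 i)⟩

lemma vanishing_antitone : Antitone (vanishing n F) :=
  antitone_nat_of_succ_le vanishing_succ_le

/-- Product rule: a derivative of `x_i φ` is `x_i` times a derivative of `φ`, handled by induction,
plus a multiple of `φ` itself. -/
lemma coordCLM_mem_vanishing {s : ℕ} {φ : 𝓢(E n, F)} (hφ : φ ∈ vanishing n F s) (i : Fin n) :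
    coordCLM F i φ ∈ vanishing n F (s + 1) := by
  induction s generalizing φ with
  | zero =>
    rw [mem_vanishing_succ]
    exact ⟨by simp [coordCLM_apply], fun _ => Submodule.mem_top⟩
  | succ s ih =>
    rw [mem_vanishing_succ]
    refine ⟨by simp [coordCLM_apply], fun j => ?_⟩
    rw [partialCLM_coordCLM]
    exact add_mem (ih ((mem_vanishing_succ.1 hφ).2 j)) (Submodule.smul_mem _ _ hφ)

lemma normSqCLM_eq_sum (φ : 𝓢(E n, F)) :
    normSqCLM F n φ = ∑ i, coordCLM F i (coordCLM F i φ) := by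
  ext x
  rw [normSqCLM_apply, sum_apply]
  simp only [coordCLM_apply, smul_smul, ← Finset.sum_smul, EuclideanSpace.norm_sq_eq]
  simp [pow_two]

lemma normSqCLM_mem_vanishing {s : ℕ} {φ : 𝓢(E n, F)} (hφ : φ ∈ vanishing n F s) :
    normSqCLM F n φ ∈ vanishing n F s := by
  rw [normSqCLM_eq_sum]
  exact Submodule.sum_mem _ fun i _ => vanishing_succ_le _ <| vanishing_succ_le _ <|
    coordCLM_mem_vanishing (coordCLM_mem_vanishing hφ i) i

/-- The map `y ↦ dx_i ⊗ y`. -/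
def coordSmulRight (F : Type*) [NormedAddCommGroup F] [NormedSpace ℂ F] (i : Fin n) :
    F →L[ℝ] E n →L[ℝ] F :=
  ContinuousLinearMap.smulRightL ℝ (E n) F (EuclideanSpace.proj i)

lemma fderiv_eq_sum (φ : 𝓢(E n, F)) :
    fderiv ℝ φ = fun x => ∑ i, coordSmulRight F i (partialCLM F i φ x) := by
  funext x
  refine ContinuousLinearMap.ext fun v => ?_
  have hv : v = ∑ i, v i • e i := by
    simpa [e] using ((EuclideanSpace.basisFun (Fin n) ℝ).sum_repr v).symm
  conv_lhs => rw [hv, map_sum]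
  rw [sum_apply]
  refine Finset.sum_congr rfl fun i _ => ?_
  rw [map_smul]
  rfl

/-- Expresses one order of differentiation through the partial derivatives, so that seminorm
estimates can follow the recursion defining `vanishing`. -/
lemma seminorm_succ_le (a l : ℕ) (φ : 𝓢(E n, F)) :
    SchwartzMap.seminorm ℂ a (l + 1) φ ≤
      ∑ i, ‖coordSmulRight F i‖ * SchwartzMap.seminorm ℂ a l (partialCLM F i φ) := by
  refine SchwartzMap.seminorm_le_bound ℂ a (l + 1) φ
    (Finset.sum_nonneg fun i _ => mul_nonneg (by positivity) (apply_nonneg _ _)) fun x => ?_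
  have hs : iteratedFDeriv ℝ l (fun y => ∑ i, coordSmulRight F i (partialCLM F i φ y)) x =
      ∑ i, iteratedFDeriv ℝ l (coordSmulRight F i ∘ partialCLM F i φ) x :=
    iteratedFDeriv_fun_sum_apply fun i _ =>
      ((coordSmulRight F i).contDiff.comp ((partialCLM F i φ).smooth l)).contDiffAt
  rw [← norm_iteratedFDeriv_fderiv, fderiv_eq_sum, hs]
  refine (mul_le_mul_of_nonneg_left (norm_sum_le _ _) (by positivity)).trans ?_
  rw [Finset.mul_sum]
  refine Finset.sum_le_sum fun i _ => ?_
  have h := (coordSmulRight F i).norm_iteratedFDeriv_comp_left (n := l) (N := l) (x := x)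
    ((partialCLM F i φ).smooth l).contDiffAt le_rfl
  refine (mul_le_mul_of_nonneg_left h (by positivity)).trans ?_
  rw [mul_left_comm]
  exact mul_le_mul_of_nonneg_left (SchwartzMap.le_seminorm ℂ a l _ x) (norm_nonneg _)

lemma continuous_seminorm_sum {ι V : Type*} [AddCommGroup V] [Module ℂ V] [TopologicalSpace V]
    (t : Finset ι) (q : ι → Seminorm ℂ V) (hq : ∀ i, Continuous (q i)) :
    Continuous (∑ i ∈ t, q i : Seminorm ℂ V) := by
  have h : ⇑(∑ i ∈ t, q i) = fun v => ∑ i ∈ t, q i v := funext fun v => sum_apply _ _ _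
  rw [h]
  exact continuous_finsetSum t fun i _ => hq i

/-- A Taylor estimate. Where `‖x‖ ≥ 1` the factor `‖x‖ ^ s` only helps and a Schwartz seminorm
suffices. Where `‖x‖ ≤ 1`, the bound for the partial derivatives and the mean value inequality on
the ball of radius `‖x‖` gain one power of `‖x‖`. -/
lemma exists_seminorm_norm_pow_mul_le (s a : ℕ) :
    ∃ q : Seminorm ℂ 𝓢(E n, F), Continuous q ∧ ∀ φ ∈ vanishing n F s, ∀ x,
      ‖x‖ ^ a * ‖φ x‖ ≤ q φ * ‖x‖ ^ s := by
  induction s generalizing a with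
  | zero =>
    exact ⟨SchwartzMap.seminorm ℂ a 0,
      (schwartz_withSeminorms ℂ (E n) F).continuous_seminorm (a, 0), fun φ _ x => by
        simpa using SchwartzMap.norm_pow_mul_le_seminorm ℂ φ a x⟩
  | succ s ih =>
    -- Derivatives are only estimated in the unit ball, where `‖x‖ ^ a ≤ 1`, so weight `0` is
    -- enough.
    obtain ⟨q, hqc, hq⟩ := ih 0
    refine ⟨SchwartzMap.seminorm ℂ a 0 +
      ∑ i, ‖coordSmulRight F i‖₊ • q.comp (partialCLM F i).toLinearMap, ?_, fun φ hφ x => ?_⟩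
    · refine ((schwartz_withSeminorms ℂ (E n) F).continuous_seminorm (a, 0)).add
        (continuous_seminorm_sum _ _ fun i => ?_)
      exact (hqc.comp (partialCLM F i).continuous).const_smul ‖coordSmulRight F i‖₊
    obtain ⟨h0, hd⟩ := mem_vanishing_succ.1 hφ
    have hsum : (SchwartzMap.seminorm ℂ a 0 + ∑ i, ‖coordSmulRight F i‖₊ •
        q.comp (partialCLM F i).toLinearMap : Seminorm ℂ 𝓢(E n, F)) φ =
        SchwartzMap.seminorm ℂ a 0 φ + ∑ i, ‖coordSmulRight F i‖ * q (partialCLM F i φ) := by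
      rw [add_apply, sum_apply]
      rfl
    rw [hsum]
    have hnn : 0 ≤ ∑ i, ‖coordSmulRight F i‖ * q (partialCLM F i φ) :=
      Finset.sum_nonneg fun i _ => mul_nonneg (by positivity) (apply_nonneg _ _)
    rcases le_total 1 ‖x‖ with hx | hx
    · refine (SchwartzMap.norm_pow_mul_le_seminorm ℂ φ a x).trans ?_
      refine (le_add_of_nonneg_right hnn).trans (le_mul_of_one_le_right ?_ (one_le_pow₀ hx))
      exact add_nonneg (apply_nonneg _ _) hnn
    · have hb : ∀ y ∈ Metric.closedBall (0 : E n) ‖x‖, ‖fderiv ℝ φ y‖ ≤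
          (∑ i, ‖coordSmulRight F i‖ * q (partialCLM F i φ)) * ‖x‖ ^ s := fun y hy => by
        rw [fderiv_eq_sum, Finset.sum_mul]
        refine (norm_sum_le _ _).trans (Finset.sum_le_sum fun i _ => ?_)
        refine ((coordSmulRight F i).le_opNorm _).trans ?_
        rw [mul_assoc]
        refine mul_le_mul_of_nonneg_left ?_ (norm_nonneg _)
        refine (by simpa using hq _ (hd i) y : _ ≤ q (partialCLM F i φ) * ‖y‖ ^ s).trans ?_
        exact mul_le_mul_of_nonneg_left
          (pow_le_pow_left₀ (norm_nonneg _) (by simpa using hy) _) (apply_nonneg _ _)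
      have h := (convex_closedBall (0 : E n) ‖x‖).norm_image_sub_le_of_norm_fderiv_le
        (fun y _ => φ.differentiableAt) hb (Metric.mem_closedBall_self (norm_nonneg x))
        (show x ∈ _ by simp)
      rw [h0, sub_zero, sub_zero, mul_assoc, ← pow_succ] at h
      calc ‖x‖ ^ a * ‖φ x‖ ≤ 1 * ‖φ x‖ :=
            mul_le_mul_of_nonneg_right (pow_le_one₀ (norm_nonneg _) hx) (norm_nonneg _)
        _ ≤ _ := by
            rw [one_mul]
            refine h.trans (mul_le_mul_of_nonneg_right ?_ (by positivity))
            exact le_add_of_nonneg_left (apply_nonneg _ _)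

lemma norm_resolvent_pow_mul_le {c : ℝ} (hc : 0 < c) (j : ℕ) (x : E n) :
    ‖resolvent c x ^ j‖ * ‖x‖ ^ (2 * j) ≤ 1 := by
  rw [norm_pow, pow_mul, ← mul_pow]
  refine pow_le_one₀ (by positivity) ?_
  have hpos : 0 < c ^ 2 + ‖x‖ ^ 2 := by positivity
  rw [resolvent, Complex.norm_real, Real.norm_of_nonneg (by positivity), inv_mul_le_one₀ hpos]
  exact le_add_of_nonneg_left (sq_nonneg c)

/-- The point is that `q` does not depend on `c`. Without derivatives, vanishing to order `2j`
absorbs the `j`-th power of the resolvent. A derivative produces `∂_i φ` with power `j` and `x_i φ`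
with power `j + 1`; both vanish to the order required for `l` derivatives, hence the induction over
all `j`. -/
lemma exists_seminorm_resolventCLM_le (a l j : ℕ) :
    ∃ q : Seminorm ℂ 𝓢(E n, F), Continuous q ∧ ∀ φ ∈ vanishing n F (2 * j + l), ∀ c : ℝ, 0 < c →
      SchwartzMap.seminorm ℂ a l (resolventCLM F c j φ) ≤ q φ := by
  induction l generalizing j with
  | zero =>
    obtain ⟨q, hqc, hq⟩ := exists_seminorm_norm_pow_mul_le (n := n) (F := F) (2 * j) a
    refine ⟨q, hqc, fun φ hφ c hc => SchwartzMap.seminorm_le_bound ℂ a 0 _ (apply_nonneg _ _)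
      fun x => ?_⟩
    rw [norm_iteratedFDeriv_zero, resolventCLM_apply hc, norm_smul, mul_left_comm]
    refine (mul_le_mul_of_nonneg_left (hq φ hφ x) (norm_nonneg _)).trans ?_
    rw [mul_left_comm]
    exact mul_le_of_le_one_right (apply_nonneg _ _) (norm_resolvent_pow_mul_le hc j x)
  | succ l ih =>
    obtain ⟨q, hqc, hq⟩ := ih j
    obtain ⟨r, hrc, hr⟩ := ih (j + 1)
    refine ⟨∑ i, ‖coordSmulRight F i‖₊ • (q.comp (partialCLM F i).toLinearMap +
      (2 * j : NNReal) • r.comp (coordCLM F i).toLinearMap),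
      continuous_seminorm_sum _ _ fun i => ?_, fun φ hφ c hc => ?_⟩
    · exact ((hqc.comp (partialCLM F i).continuous).add
        ((hrc.comp (coordCLM F i).continuous).const_smul (2 * j : NNReal))).const_smul
          ‖coordSmulRight F i‖₊
    · rw [sum_apply]
      refine (seminorm_succ_le a l _).trans (Finset.sum_le_sum fun i _ => ?_)
      refine mul_le_mul_of_nonneg_left ?_ (by positivity)
      rw [partialCLM_resolventCLM hc]
      refine (map_sub_le_add _ _ _).trans (add_le_add ?_ ?_)
      · exact hq _ ((mem_vanishing_succ.1 hφ).2 i) c hc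
      · rw [map_smul_eq_mul]
        have h2 : ‖(2 * j : ℂ)‖ = 2 * j := by simp
        rw [h2]
        refine mul_le_mul_of_nonneg_left (hr _ ?_ c hc) (by positivity)
        have h3 : 2 * (j + 1) + l = 2 * j + (l + 1) + 1 := by ring
        rw [h3]
        exact coordCLM_mem_vanishing hφ i

lemma exists_seminorm_functional_resolventCLM_le (T : 𝓢(E n, F) →L[ℂ] ℂ) :
    ∃ (s : ℕ) (q : Seminorm ℂ 𝓢(E n, F)), Continuous q ∧ ∀ φ ∈ vanishing n F s, ∀ c : ℝ, 0 < c →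
      ‖T (resolventCLM F c 1 φ)‖ ≤ q φ := by
  obtain ⟨t, C, -, hC⟩ := Seminorm.bound_of_continuous (schwartz_withSeminorms ℂ (E n) F)
    T.toLinearMap.toSeminorm T.continuous.norm
  choose q hqc hq using fun m : ℕ × ℕ =>
    exists_seminorm_resolventCLM_le (n := n) (F := F) m.1 m.2 1
  -- The `2` pays for one resolvent factor, and `t.sup Prod.snd` is the highest order of
  -- differentiation in the seminorms controlling `T`.
  refine ⟨2 + t.sup Prod.snd, C • ∑ m ∈ t, q m,
    (continuous_seminorm_sum t q hqc).const_smul C, fun φ hφ c hc => ?_⟩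
  refine (hC _).trans ?_
  refine mul_le_mul_of_nonneg_left ?_ C.2
  rw [sum_apply]
  refine Seminorm.finset_sup_apply_le (Finset.sum_nonneg fun _ _ => apply_nonneg _ _)
    fun m hm => ?_
  refine (hq m φ (vanishing_antitone ?_ hφ) c hc).trans
    (Finset.single_le_sum (f := fun m => q m φ) (fun _ _ => apply_nonneg _ _) hm)
  simpa using Finset.le_sup (f := Prod.snd) hm

/-- Dividing `|x|² φ` by `c² + |x|²` returns `φ` up to an error with a factor `c²`, which disappears
as `c → 0`. -/
lemma resolventCLM_normSqCLM {c : ℝ} (hc : 0 < c) (φ : 𝓢(E n, F)) :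
    resolventCLM F c 1 (normSqCLM F n φ) + (c ^ 2 : ℂ) • resolventCLM F c 1 φ = φ := by
  ext x
  change resolventCLM F c 1 (normSqCLM F n φ) x + (c ^ 2 : ℂ) • resolventCLM F c 1 φ x = φ x
  rw [resolventCLM_apply hc, resolventCLM_apply hc, normSqCLM_apply, smul_smul, smul_smul,
    ← add_smul]
  have hpos : c ^ 2 + ‖x‖ ^ 2 ≠ 0 := by positivity
  have h : resolvent c x ^ 1 * ((‖x‖ ^ 2 : ℝ) : ℂ) + (c : ℂ) ^ 2 * resolvent c x ^ 1 = 1 := by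
    rw [pow_one, resolvent, mul_comm ((c : ℂ) ^ 2), ← mul_add, ← Complex.ofReal_pow,
      ← Complex.ofReal_add, ← Complex.ofReal_mul, add_comm (‖x‖ ^ 2), inv_mul_cancel₀ hpos,
      Complex.ofReal_one]
  rw [h, one_smul]

/-- A functional is controlled, on functions vanishing to high order at the origin, by the
product of its argument with `|x|²`. -/
lemma exists_seminorm_functional_le_normSqCLM (T : 𝓢(E n, F) →L[ℂ] ℂ) :
    ∃ (s : ℕ) (q : Seminorm ℂ 𝓢(E n, F)), Continuous q ∧ ∀ φ ∈ vanishing n F s,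
      ‖T φ‖ ≤ q (normSqCLM F n φ) := by
  obtain ⟨s, q, hqc, hq⟩ := exists_seminorm_functional_resolventCLM_le T
  refine ⟨s, q, hqc, fun φ hφ => ?_⟩
  -- Both `|x|² φ` and `φ` vanish to order `s`, so the uniform bound applies to each term.
  have h : ∀ c : ℝ, 0 < c → ‖T φ‖ ≤ q (normSqCLM F n φ) + c ^ 2 * q φ := fun c hc => by
    conv_lhs => rw [← resolventCLM_normSqCLM hc φ, map_add, map_smul]
    refine (norm_add_le _ _).trans (add_le_add (hq _ (normSqCLM_mem_vanishing hφ) c hc) ?_)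
    rw [norm_smul]
    have : ‖(c ^ 2 : ℂ)‖ = c ^ 2 := by simp
    rw [this]
    exact mul_le_mul_of_nonneg_left (hq φ hφ c hc) (by positivity)
  have hlim : Filter.Tendsto (fun c : ℝ => q (normSqCLM F n φ) + c ^ 2 * q φ)
      (nhdsWithin 0 (Set.Ioi 0)) (nhds (q (normSqCLM F n φ))) := by
    have : Continuous fun c : ℝ => q (normSqCLM F n φ) + c ^ 2 * q φ := by fun_prop
    simpa using (this.tendsto 0).mono_left nhdsWithin_le_nhds
  exact ge_of_tendsto hlim (Filter.eventually_of_mem self_mem_nhdsWithin h)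

/-- Division of functionals by `|x|²`, up to a functional supported at the origin. -/
lemma exists_division (T : 𝓢(E n, F) →L[ℂ] ℂ) :
    ∃ (W : 𝓢(E n, F) →L[ℂ] ℂ) (s : ℕ), ∀ φ ∈ vanishing n F s, T φ = W (normSqCLM F n φ) := by
  obtain ⟨s, q, hqc, hq⟩ := exists_seminorm_functional_le_normSqCLM T
  let R : vanishing n F s →ₗ[ℂ] 𝓢(E n, F) :=
    (normSqCLM F n).toLinearMap.comp (vanishing n F s).subtype
  -- By the bound, `T φ` depends only on `|x|² φ`; this makes the functional `f : |x|² φ ↦ T φ` well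
  -- defined on the range of `R`.
  have hR : LinearMap.ker R ≤ LinearMap.ker (T.toLinearMap.comp (vanishing n F s).subtype) := by
    intro φ hφ
    have h1 : normSqCLM F n φ.1 = 0 := hφ
    have h2 := hq φ.1 φ.2
    rw [h1, map_zero] at h2
    exact norm_le_zero_iff.1 h2
  let f : LinearMap.range R →ₗ[ℂ] ℂ :=
    ((LinearMap.ker R).liftQ _ hR).comp R.quotKerEquivRange.symm.toLinearMap
  have hf : ∀ φ : vanishing n F s, f ⟨R φ, φ, rfl⟩ = T φ.1 := fun φ => by
    have : R.quotKerEquivRange.symm ⟨R φ, φ, rfl⟩ = (LinearMap.ker R).mkQ φ := by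
      rw [LinearEquiv.symm_apply_eq]
      rfl
    change (LinearMap.ker R).liftQ _ hR (R.quotKerEquivRange.symm _) = _
    rw [this]
    rfl
  have hpoly : PolynormableSpace ℂ 𝓢(E n, F) :=
    (schwartz_withSeminorms ℂ (E n) F).toPolynormableSpace
  -- Hahn–Banach: `f` is dominated by the continuous seminorm `q`.
  obtain ⟨W, hW, -⟩ := Module.Dual.exists_continuous_extension_of_le_seminorm
    (LinearMap.range R) f hqc (by
      rintro ⟨_, φ, rfl⟩
      rw [hf]
      exact hq φ.1 φ.2)
  exact ⟨W, s, fun φ hφ => ((hW ⟨R ⟨φ, hφ⟩, ⟨φ, hφ⟩, rfl⟩).trans (hf ⟨φ, hφ⟩)).symm⟩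

/-- A functional annihilated by `|x|²` is supported at the origin. -/
lemma exists_vanishing_le_ker (T : 𝓢(E n, F) →L[ℂ] ℂ) (hT : ∀ φ, T (normSqCLM F n φ) = 0) :
    ∃ s, ∀ φ ∈ vanishing n F s, T φ = 0 := by
  obtain ⟨s, q, -, hq⟩ := exists_seminorm_functional_resolventCLM_le T
  refine ⟨s, fun φ hφ => ?_⟩
  -- Once `|x|²` is moved outermost, `T` kills the main term and only the error with factor `c²`
  -- remains.
  have hcomm : ∀ c : ℝ, 0 < c →
      resolventCLM F c 1 (normSqCLM F n φ) = normSqCLM F n (resolventCLM F c 1 φ) := fun c hc => by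
    ext x
    rw [resolventCLM_apply hc, normSqCLM_apply, normSqCLM_apply, resolventCLM_apply hc, smul_comm]
  have h : ∀ c : ℝ, 0 < c → ‖T φ‖ ≤ c ^ 2 * q φ := fun c hc => by
    conv_lhs => rw [← resolventCLM_normSqCLM hc φ, map_add, map_smul, hcomm c hc, hT, zero_add,
      norm_smul]
    have : ‖(c ^ 2 : ℂ)‖ = c ^ 2 := by simp
    rw [this]
    exact mul_le_mul_of_nonneg_left (hq φ hφ c hc) (by positivity)
  have hlim : Filter.Tendsto (fun c : ℝ => c ^ 2 * q φ) (nhdsWithin 0 (Set.Ioi 0)) (nhds 0) := by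
    have : Continuous fun c : ℝ => c ^ 2 * q φ := by fun_prop
    simpa using (this.tendsto 0).mono_left nhdsWithin_le_nhds
  exact norm_le_zero_iff.1
    (ge_of_tendsto hlim (Filter.eventually_of_mem self_mem_nhdsWithin h))

end Division

/-! ### The Laplacian on polynomials and polynomial forms. -/

section Polynomials

variable {n k : ℕ}

/-- The operator `∑ i, ∂_i²` on polynomials. -/
def mvLaplacian (n : ℕ) : MvPolynomial (Fin n) ℂ →ₗ[ℂ] MvPolynomial (Fin n) ℂ :=
  ∑ i, (MvPolynomial.pderiv i).toLinearMap.comp (MvPolynomial.pderiv i).toLinearMap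

lemma mvLaplacian_apply (p : MvPolynomial (Fin n) ℂ) :
    mvLaplacian n p = ∑ i, MvPolynomial.pderiv i (MvPolynomial.pderiv i p) := by
  simp [mvLaplacian]

/-- Integrating twice in `x_{i₀}` inverts `∂_{i₀}²` on the monomial. The other second derivatives
leave errors of smaller total degree in the variables other than `x_{i₀}`, and the induction is on
that degree. -/
lemma monomial_mem_range_mvLaplacian (i₀ : Fin n) (m : Fin n →₀ ℕ) (c : ℂ) :
    MvPolynomial.monomial m c ∈ LinearMap.range (mvLaplacian n) := by
  induction hN : ∑ i ∈ Finset.univ.erase i₀, m i using Nat.strong_induction_on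
    generalizing m c with
  | h N ih =>
    subst hN
    let m' : Fin n →₀ ℕ := m + Finsupp.single i₀ 2
    let a : ℂ := c / ((m i₀ + 1) * (m i₀ + 2))
    have h0 : (m i₀ + 1 : ℂ) ≠ 0 := by exact_mod_cast Nat.succ_ne_zero (m i₀)
    have h1 : (m i₀ + 2 : ℂ) ≠ 0 := by exact_mod_cast Nat.succ_ne_zero (m i₀ + 1)
    have key : mvLaplacian n (MvPolynomial.monomial m' a) =
        MvPolynomial.monomial m c + ∑ i ∈ Finset.univ.erase i₀,
          MvPolynomial.pderiv i (MvPolynomial.pderiv i (MvPolynomial.monomial m' a)) := by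
      rw [mvLaplacian_apply, ← Finset.add_sum_erase _ _ (Finset.mem_univ i₀)]
      congr 1
      rw [MvPolynomial.pderiv_monomial, MvPolynomial.pderiv_monomial]
      congr 1
      · congr 1
        ext j
        by_cases hj : j = i₀
        · subst hj; simp [m']
        · simp [m', Ne.symm hj]
      · simp only [m', a, Finsupp.add_apply, Finsupp.single_eq_same, Finsupp.tsub_apply]
        simp
        field_simp
    rw [← sub_eq_iff_eq_add] at key
    rw [← key]
    refine sub_mem (LinearMap.mem_range_self _ _) (Submodule.sum_mem _ fun i hi => ?_)
    have hi' : i ≠ i₀ := Finset.ne_of_mem_erase hi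
    rw [MvPolynomial.pderiv_monomial, MvPolynomial.pderiv_monomial]
    -- Exponents subtract with truncation, so the degree need not drop by two when `m i < 2`; in
    -- that case the coefficient is zero.
    by_cases h2 : m i < 2
    · have h3 : a * m' i * (((m' - Finsupp.single i 1 : Fin n →₀ ℕ) i : ℕ) : ℂ) = 0 := by
        have h4 : m' i = m i := by simp [m', hi']
        rw [Finsupp.tsub_apply, h4, Finsupp.single_eq_same]
        interval_cases m i <;> simp
      rw [h3, map_zero]
      exact zero_mem _
    · refine ih _ (Finset.sum_lt_sum (fun j hj => ?_) ⟨i, hi, ?_⟩) _ _ rfl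
      · have hj' : j ≠ i₀ := Finset.ne_of_mem_erase hj
        simp [m', hj'.symm, add_assoc]
      · simp [m', hi'.symm]
        omega

lemma mvLaplacian_surjective (hn : 1 ≤ n) : Function.Surjective (mvLaplacian n) := by
  intro p
  change p ∈ LinearMap.range (mvLaplacian n)
  rw [p.as_sum]
  exact Submodule.sum_mem _ fun m _ => monomial_mem_range_mvLaplacian ⟨0, hn⟩ m _

/-- A complex polynomial is determined by its values on a product of infinite sets, here copies of
`ℝ ⊂ ℂ`. -/
lemma polyFun_injective : Function.Injective (polyFun (n := n)) := by
  intro p q h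
  refine MvPolynomial.funext_set (fun _ => Set.range ((↑) : ℝ → ℂ))
    (fun _ => Set.infinite_range_of_injective Complex.ofReal_injective) fun x hx => ?_
  choose y hy using fun i => hx i trivial
  have h1 := congrFun h (WithLp.toLp 2 y)
  simpa [polyFun, hy] using h1

/-- The form `dx_{i_1} ∧ ⋯ ∧ dx_{i_k}`. -/
def dualForm (I : Fin k ↪o Fin n) : Form n k :=
  Form.ofAlt
    { ((Complex.ofRealCLM.toLinearMap).compAlternatingMap
        ((Matrix.detRowAlternating (R := ℝ) (n := Fin k)).compLinearMap
          (LinearMap.pi fun l => (EuclideanSpace.proj (I l) : E n →L[ℝ] ℝ).toLinearMap))) with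
      cont := by
        change Continuous fun v : Fin k → E n =>
          ((Matrix.det (Matrix.of fun j l => v j (I l)) : ℝ) : ℂ)
        refine Complex.continuous_ofReal.comp (Continuous.matrix_det ?_)
        exact continuous_pi fun j => continuous_pi fun l =>
          (EuclideanSpace.proj (I l) : E n →L[ℝ] ℝ).continuous.comp (continuous_apply j) }

lemma coeff_dualForm (I J : Fin k ↪o Fin n) :
    coeff J (dualForm I) = if J = I then 1 else 0 := by
  have h : coeff J (dualForm I) =
      ((Matrix.det (Matrix.of fun j l => (e (J j) : E n) (I l)) : ℝ) : ℂ) := rfl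
  rw [h]
  split_ifs with hJ
  · subst hJ
    have : (Matrix.of fun j l => (e (J j) : E n) (J l)) = (1 : Matrix (Fin k) (Fin k) ℝ) := by
      ext j l
      simp [e, Matrix.one_apply, eq_comm]
    rw [this, Matrix.det_one, Complex.ofReal_one]
  -- Otherwise `J = I ∘ f` with `f` a strictly increasing bijection of `Fin k`, so `f = id` and `J =
  -- I`. The index found gives a zero row of the determinant.
  · obtain ⟨j, hj⟩ : ∃ j, ∀ l, I l ≠ J j := by
      by_contra! hcon
      choose f hf using hcon
      have hinj : Function.Injective f := fun a b hab =>
        J.injective (by rw [← hf a, ← hf b, hab])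
      have hsurj := Finite.surjective_of_injective hinj
      have hmono : StrictMono f := fun a b hab => by
        rw [← I.lt_iff_lt, hf, hf]
        exact J.strictMono hab
      have hid : f = id :=
        (hmono.range_inj strictMono_id).1 (by rw [hsurj.range_eq, Set.range_id])
      exact hJ (RelEmbedding.ext fun a => by rw [← hf a, hid]; rfl)
    rw [Matrix.det_eq_zero_of_row_eq_zero j, Complex.ofReal_zero]
    intro l
    simp [e, hj l]

lemma coeff_sum_smul_dualForm (a : (Fin k ↪o Fin n) → ℂ) (J : Fin k ↪o Fin n) :
    coeff J (∑ I, a I • dualForm I) = a J := by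
  simp [map_sum, coeff_dualForm]

/-- The polynomial form with given coefficients. -/
def ofCoeffs (p : (Fin k ↪o Fin n) → MvPolynomial (Fin n) ℂ) : polyForms n k :=
  ⟨fun x => ∑ I, polyFun (p I) x • dualForm I,
    fun I => ⟨p I, fun _ => coeff_sum_smul_dualForm _ I⟩⟩

lemma coeff_ofCoeffs (p : (Fin k ↪o Fin n) → MvPolynomial (Fin n) ℂ) (I : Fin k ↪o Fin n)
    (x : E n) : coeff I ((ofCoeffs p).1 x) = polyFun (p I) x :=
  coeff_sum_smul_dualForm _ I

lemma polyForms_ext {θ η : polyForms n k} (h : ∀ I x, coeff I (θ.1 x) = coeff I (η.1 x)) :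
    θ = η :=
  Subtype.ext (funext fun x => form_ext fun I => h I x)

lemma coeff_polyLaplacian {θ : polyForms n k} {I : Fin k ↪o Fin n} {p : MvPolynomial (Fin n) ℂ}
    (hp : ∀ x, coeff I (θ.1 x) = polyFun p x) (x : E n) :
    coeff I ((polyLaplacian n k θ).1 x) = polyFun (-mvLaplacian n p) x := by
  have h := (polyForms_contDiff θ 2).contDiffAt (x := x) |>.laplacian_CLM_comp_left
    (l := (coeff I).restrictScalars ℝ)
  have h' : ((coeff I).restrictScalars ℝ : Form n k → ℂ) ∘ (θ : E n → Form n k) = polyFun p :=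
    funext hp
  rw [h', polyFun_laplacian, ← mvLaplacian_apply] at h
  have h'' : polyFun (-mvLaplacian n p) x = -polyFun (mvLaplacian n p) x := by simp [polyFun]
  rw [h'', h]
  exact map_neg (coeff I) _

lemma polyLaplacian_surjective (hn : 1 ≤ n) : Function.Surjective (polyLaplacian n k) := by
  intro θ
  choose p hp using θ.2
  choose q hq using fun I => mvLaplacian_surjective hn (-p I)
  refine ⟨ofCoeffs q, polyForms_ext fun I x => ?_⟩
  rw [coeff_polyLaplacian (coeff_ofCoeffs q I), hq, neg_neg, hp]

lemma polyLaplacian_eq_zero_iff {θ : polyForms n k} :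
    polyLaplacian n k θ = 0 ↔ θ.1 ∈ harmonicForms n k := by
  constructor
  · intro h I
    obtain ⟨p, hp⟩ := θ.2 I
    refine ⟨p, ?_, hp⟩
    rw [← mvLaplacian_apply, ← neg_eq_zero]
    refine polyFun_injective (funext fun x => ?_)
    rw [← coeff_polyLaplacian hp, h]
    simp [polyFun]
  · intro h
    refine polyForms_ext fun I x => ?_
    obtain ⟨p, hp0, hp⟩ := h I
    rw [coeff_polyLaplacian hp, mvLaplacian_apply, hp0]
    simp [polyFun]

lemma harmonicToPoly_injective : Function.Injective (harmonicToPoly n k) :=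
  Submodule.inclusion_injective _

lemma harmonicToPoly_exact : Function.Exact (harmonicToPoly n k) (polyLaplacian n k) := by
  intro θ
  rw [polyLaplacian_eq_zero_iff]
  constructor
  · intro h
    exact ⟨⟨θ.1, h⟩, rfl⟩
  · rintro ⟨η, rfl⟩
    exact η.2

end Polynomials

/-! ### Polynomial forms as currents: compatibility with `Δ`, and injectivity. -/

section PolynomialCurrents

variable {n k : ℕ}

/-- Multiplication of rapidly decreasing functions by a polynomial. -/
def polyMulCLM (p : MvPolynomial (Fin n) ℂ) : 𝓢(E n, ℂ) →L[ℂ] 𝓢(E n, ℂ) :=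
  SchwartzMap.smulLeftCLM ℂ (polyFun p)

lemma polyMulCLM_apply (p : MvPolynomial (Fin n) ℂ) (f : 𝓢(E n, ℂ)) (x : E n) :
    polyMulCLM p f x = polyFun p x * f x :=
  SchwartzMap.smulLeftCLM_apply_apply (polyFun_hasTemperateGrowth p) f x

lemma integrable_polyFun_mul (p : MvPolynomial (Fin n) ℂ) (f : 𝓢(E n, ℂ)) :
    MeasureTheory.Integrable fun x => polyFun p x * f x := by
  have h : (fun x => polyFun p x * f x) = polyMulCLM p f :=
    funext fun x => (polyMulCLM_apply p f x).symm
  rw [h]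
  exact (polyMulCLM p f).integrable

lemma integral_polyFun_mul_partialCLM (p : MvPolynomial (Fin n) ℂ) (f : 𝓢(E n, ℂ)) (i : Fin n) :
    ∫ x, polyFun p x * partialCLM ℂ i f x =
      -∫ x, polyFun (MvPolynomial.pderiv i p) x * f x := by
  refine integral_bilinear_hasLineDerivAt_right_eq_neg_left_of_integrable (v := e i)
    (B := ContinuousLinearMap.mul ℝ ℂ) (integrable_polyFun_mul _ f)
    (integrable_polyFun_mul p _) (integrable_polyFun_mul p f) (fun x _ => ?_) fun x _ => ?_
  · convert (polyFun_hasFDerivAt p x).hasLineDerivAt (e i) using 1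
    simp [e, apply_ite]
  · exact (f.hasFDerivAt x).hasLineDerivAt (e i)

/-- The coefficient of `dx_I` in a rapidly decreasing form. -/
def testCoeff (I : Fin k ↪o Fin n) : TestForm n k →L[ℂ] 𝓢(E n, ℂ) :=
  SchwartzMap.postcompCLM (coeff I)

lemma testCoeff_apply (I : Fin k ↪o Fin n) (φ : TestForm n k) (x : E n) :
    testCoeff I φ x = coeff I (φ x) := rfl

lemma testCoeff_testPartial (I : Fin k ↪o Fin n) (i : Fin n) (φ : TestForm n k) :
    testCoeff I (testPartial i φ) = partialCLM ℂ i (testCoeff I φ) := by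
  ext x
  have h : HasFDerivAt (testCoeff I φ) _ x :=
    ((coeff I).restrictScalars ℝ).hasFDerivAt.comp x (φ.hasFDerivAt x)
  rw [partialCLM_apply, h.fderiv]
  rfl

lemma polyToCurrent_eq_sum {θ : polyForms n k} {p : (Fin k ↪o Fin n) → MvPolynomial (Fin n) ℂ}
    (hp : ∀ I x, coeff I (θ.1 x) = polyFun (p I) x) (φ : TestForm n k) :
    polyToCurrent n k θ φ = ∑ I, ∫ x, polyFun (p I) x * testCoeff I φ x := by
  rw [polyToCurrent_apply, ← MeasureTheory.integral_finsetSum _ fun I _ =>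
    integrable_polyFun_mul (p I) (testCoeff I φ)]
  simp only [hp, testCoeff_apply]

lemma testLaplacian_apply (φ : TestForm n k) :
    testLaplacian n k φ = -∑ i, testPartial i (testPartial i φ) := by
  simp [testLaplacian, sum_apply]

lemma integral_polyFun_mul_testLaplacian (p : MvPolynomial (Fin n) ℂ) (I : Fin k ↪o Fin n)
    (φ : TestForm n k) :
    ∫ x, polyFun p x * testCoeff I (testLaplacian n k φ) x =
      ∫ x, polyFun (-mvLaplacian n p) x * testCoeff I φ x := by
  have h1 : testCoeff I (testLaplacian n k φ) =
      -∑ i, partialCLM ℂ i (partialCLM ℂ i (testCoeff I φ)) := by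
    rw [testLaplacian_apply, map_neg, map_sum]
    simp only [testCoeff_testPartial]
  have h2 : ∀ x, polyFun p x * testCoeff I (testLaplacian n k φ) x =
      -∑ i, polyFun p x * partialCLM ℂ i (partialCLM ℂ i (testCoeff I φ)) x := fun x => by
    rw [h1, neg_apply, sum_apply, mul_neg, Finset.mul_sum]
  have h3 : ∀ x, polyFun (-mvLaplacian n p) x * testCoeff I φ x =
      -∑ i, polyFun (MvPolynomial.pderiv i (MvPolynomial.pderiv i p)) x * testCoeff I φ x :=
    fun x => by
      rw [← Finset.sum_mul, ← neg_mul, mvLaplacian_apply]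
      simp [polyFun]
  simp only [h2, h3]
  rw [MeasureTheory.integral_neg, MeasureTheory.integral_neg,
    MeasureTheory.integral_finsetSum _ fun i _ => integrable_polyFun_mul _ _,
    MeasureTheory.integral_finsetSum _ fun i _ => integrable_polyFun_mul _ _]
  congr 1
  refine Finset.sum_congr rfl fun i _ => ?_
  rw [integral_polyFun_mul_partialCLM, integral_polyFun_mul_partialCLM, neg_neg]

lemma laplacian_polyToCurrent (θ : polyForms n k) :
    laplacian n k (polyToCurrent n k θ) = polyToCurrent n k (polyLaplacian n k θ) := by
  choose p hp using θ.2
  ext φ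
  change polyToCurrent n k θ (testLaplacian n k φ) = _
  rw [polyToCurrent_eq_sum hp, polyToCurrent_eq_sum fun I x => coeff_polyLaplacian (hp I) x]
  exact Finset.sum_congr rfl fun I _ => integral_polyFun_mul_testLaplacian (p I) I φ

/-- Testing against `g dx_J` with `g` smooth of compact support isolates the coefficient `p J`,
which is then zero almost everywhere, and everywhere by continuity. -/
lemma polyToCurrent_injective : Function.Injective (polyToCurrent n k) := by
  rw [injective_iff_map_eq_zero]
  intro θ hθ
  choose p hp using θ.2
  refine polyForms_ext fun J x => ?_
  have hcont : Continuous (polyFun (p J)) := (polyFun_contDiff (p J) 0).continuous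
  have hae : ∀ᵐ y, polyFun (p J) y = 0 := by
    refine ae_eq_zero_of_integral_contDiff_smul_eq_zero hcont.locallyIntegrable
      fun g hg hgs => ?_
    have hsupp : HasCompactSupport fun y => (g y : ℂ) • dualForm J :=
      (hgs.comp_left (g := fun r : ℝ => (r : ℂ) • dualForm J) (by simp) :)
    have hsm : ContDiff ℝ (⊤ : ℕ∞) fun y => (g y : ℂ) • dualForm J :=
      (Complex.ofRealCLM.contDiff.comp hg).smul contDiff_const
    let φ : TestForm n k := hsupp.toSchwartzMap hsm
    have h := DFunLike.congr_fun hθ φ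
    rw [polyToCurrent_eq_sum hp, Finset.sum_eq_single J] at h
    · have h' : ∀ y, polyFun (p J) y * testCoeff J φ y = g y • polyFun (p J) y := fun y => by
        have : testCoeff J φ y = coeff J ((g y : ℂ) • dualForm J) := rfl
        rw [this, map_smul, coeff_dualForm, if_pos rfl, smul_eq_mul, mul_one, mul_comm,
          Complex.real_smul]
      simp only [h'] at h
      exact h
    · intro I _ hI
      have h' : ∀ y, testCoeff I φ y = 0 := fun y => by
        have : testCoeff I φ y = coeff I ((g y : ℂ) • dualForm J) := rfl
        rw [this, map_smul, coeff_dualForm, if_neg hI, smul_zero]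
      simp [h']
    · simp
  have hfun := (hcont.ae_eq_iff_eq MeasureTheory.volume continuous_const).1 hae
  rw [hp, congrFun hfun x]
  exact (map_zero (coeff J)).symm

end PolynomialCurrents

/-! ### Fourier transform: functionals supported at the origin, kernel and range of `Δ` on currents.
-/

section Fourier

variable {n k : ℕ}

instance : CompleteSpace (Form n k) :=
  inferInstanceAs (CompleteSpace (E n [⋀^Fin k]→L[ℝ] ℂ))

lemma fourier_testPartial (i : Fin n) (φ : TestForm n k) :
    𝓕 (testPartial i φ) = (2 * Real.pi * Complex.I) • coordCLM (Form n k) i (𝓕 φ) := by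
  refine (SchwartzMap.fourier_lineDerivOp_eq φ (e i)).trans ?_
  congr 1
  ext1 x
  rw [SchwartzMap.smulLeftCLM_apply_apply (by fun_prop), coordCLM_apply]
  simp [e, EuclideanSpace.inner_single_right]

lemma partialCLM_fourier (i : Fin n) (φ : TestForm n k) :
    partialCLM (Form n k) i (𝓕 φ) =
      𝓕 (-(2 * Real.pi * Complex.I) • coordCLM (Form n k) i φ) := by
  refine (SchwartzMap.lineDerivOp_fourier_eq φ (e i)).trans ?_
  congr 2
  ext1 x
  rw [SchwartzMap.smulLeftCLM_apply_apply (by fun_prop), coordCLM_apply]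
  simp [e, EuclideanSpace.inner_single_right]

/-- Each `∂_i²` becomes `(2πi x_i)² = -4π² x_i²`, and the sign cancels the one in `Δ = -∑ ∂_i²`. -/
lemma fourier_testLaplacian (φ : TestForm n k) :
    𝓕 (testLaplacian n k φ) = (4 * Real.pi ^ 2 : ℂ) • normSqCLM (Form n k) n (𝓕 φ) := by
  have h : ∀ ψ : TestForm n k, 𝓕 ψ = FourierTransform.fourierCLM ℂ (TestForm n k) ψ :=
    fun _ => rfl
  rw [testLaplacian_apply, h, map_neg, map_sum, normSqCLM_eq_sum, Finset.smul_sum,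
    ← Finset.sum_neg_distrib]
  refine Finset.sum_congr rfl fun i _ => ?_
  rw [← h, fourier_testPartial, fourier_testPartial, map_smul, smul_smul, ← neg_smul]
  congr 1
  linear_combination (-4 * (Real.pi : ℂ) ^ 2) * Complex.I_sq

variable (n k) in
/-- The linear forms whose Fourier transform is a polynomial current. -/
def fourierPolyForms : Submodule ℂ (TestForm n k →ₗ[ℂ] ℂ) where
  carrier := {f | ∃ θ : polyForms n k, ∀ φ : TestForm n k, f (𝓕 φ) = polyToCurrent n k θ φ}
  zero_mem' := ⟨0, fun φ => by rw [map_zero]; rfl⟩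
  add_mem' := by
    rintro f g ⟨θ, hθ⟩ ⟨η, hη⟩
    refine ⟨θ + η, fun φ => ?_⟩
    rw [map_add, LinearMap.add_apply, hθ, hη]
    rfl
  smul_mem' := by
    rintro c f ⟨θ, hθ⟩
    refine ⟨c • θ, fun φ => ?_⟩
    rw [map_smul, LinearMap.smul_apply, hθ]
    rfl

/-- Since `(𝓕 φ)(0) = ∫ φ`, evaluation of a coefficient at the origin corresponds to the constant
form `dx_I`. -/
lemma coeff_evalZero_mem_fourierPolyForms (I : Fin k ↪o Fin n) :
    (coeff I).toLinearMap.comp (evalZero n (Form n k)) ∈ fourierPolyForms n k := by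
  let p : (Fin k ↪o Fin n) → MvPolynomial (Fin n) ℂ := fun J => if J = I then 1 else 0
  refine ⟨ofCoeffs p, fun φ => ?_⟩
  rw [polyToCurrent_eq_sum (coeff_ofCoeffs p), Finset.sum_eq_single I]
  · have h1 : evalZero n (Form n k) (𝓕 φ) = ∫ x, φ x := by
      change 𝓕 (φ : E n → Form n k) 0 = _
      simp [Real.fourier_eq]
    rw [LinearMap.comp_apply, h1]
    refine ((coeff I).integral_comp_comm φ.integrable).symm.trans ?_
    simp [p, polyFun, testCoeff_apply]
  · intro J _ hJ
    simp [p, hJ, polyFun]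
  · simp

/-- Differentiating `𝓕 φ` multiplies `φ` by `-2πi x_i`, a factor that can be moved to the polynomial
coefficients. -/
lemma comp_partialCLM_mem_fourierPolyForms {f : TestForm n k →ₗ[ℂ] ℂ}
    (hf : f ∈ fourierPolyForms n k) (i : Fin n) :
    f.comp (partialCLM (Form n k) i).toLinearMap ∈ fourierPolyForms n k := by
  obtain ⟨θ, hθ⟩ := hf
  choose p hp using θ.2
  let q : (Fin k ↪o Fin n) → MvPolynomial (Fin n) ℂ := fun J =>
    MvPolynomial.C (-(2 * Real.pi * Complex.I)) * (MvPolynomial.X i * p J)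
  refine ⟨ofCoeffs q, fun φ => ?_⟩
  rw [LinearMap.comp_apply]
  change f (partialCLM (Form n k) i (𝓕 φ)) = _
  rw [partialCLM_fourier, hθ, polyToCurrent_eq_sum hp, polyToCurrent_eq_sum (coeff_ofCoeffs q)]
  refine Finset.sum_congr rfl fun J _ => MeasureTheory.integral_congr_ae (.of_forall fun x => ?_)
  have h : testCoeff J (-(2 * Real.pi * Complex.I) • coordCLM (Form n k) i φ) x =
      -(2 * Real.pi * Complex.I) * ((x i : ℂ) * testCoeff J φ x) := by
    rw [map_smul]
    change -(2 * Real.pi * Complex.I) * coeff J (coordCLM (Form n k) i φ x) = _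
    rw [coordCLM_apply, map_smul]
    rfl
  simp only [h, q, polyFun]
  simp
  ring

/-- The family consists of the coefficients at `0` of the iterated partial derivatives of order less
than `s`. It is built along the recursion for `vanishing`. -/
lemma exists_fourierPolyForms_iInf_ker_le (s : ℕ) :
    ∃ (ι : Type) (_ : Finite ι) (L : ι → TestForm n k →ₗ[ℂ] ℂ),
      (∀ i, L i ∈ fourierPolyForms n k) ∧
      ⨅ i, LinearMap.ker (L i) ≤ vanishing n (Form n k) s := by
  induction s with
  | zero => exact ⟨Empty, inferInstance, Empty.elim, fun i => i.elim, le_top⟩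
  | succ s ih =>
    obtain ⟨ι, _, L, hL, hker⟩ := ih
    refine ⟨(Fin k ↪o Fin n) ⊕ (Fin n × ι), inferInstance,
      Sum.elim (fun I => (coeff I).toLinearMap.comp (evalZero n (Form n k)))
        (fun a => (L a.2).comp (partialCLM (Form n k) a.1).toLinearMap), ?_, fun φ hφ => ?_⟩
    · rintro (I | ⟨i, a⟩)
      · exact coeff_evalZero_mem_fourierPolyForms I
      · exact comp_partialCLM_mem_fourierPolyForms (hL a) i
    · rw [Submodule.mem_iInf] at hφ
      rw [mem_vanishing_succ]
      refine ⟨form_ext fun I => (hφ (Sum.inl I)).trans (map_zero (coeff I)).symm, fun i => hker ?_⟩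
      rw [Submodule.mem_iInf]
      exact fun a => hφ (Sum.inr (i, a))

/-- The Fourier transform of a linear form supported at the origin is a polynomial current. -/
lemma mem_fourierPolyForms_of_vanishing {f : TestForm n k →ₗ[ℂ] ℂ} {s : ℕ}
    (hf : ∀ φ ∈ vanishing n (Form n k) s, f φ = 0) : f ∈ fourierPolyForms n k := by
  obtain ⟨ι, _, L, hL, hker⟩ := exists_fourierPolyForms_iInf_ker_le (n := n) (k := k) s
  -- Pure linear algebra: a linear form that vanishes on the common kernel of finitely many others
  -- is a combination of them, with no continuity involved.
  have h : f ∈ Submodule.span ℂ (Set.range L) :=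
    mem_span_of_iInf_ker_le_ker fun φ hφ => hf φ (hker hφ)
  exact Submodule.span_le.2 (by rintro _ ⟨i, rfl⟩; exact hL i) h

/-- The linear form `φ ↦ ⟨ω, 𝓕⁻¹ φ⟩`. -/
def fourierCurrent (ω : Current n k) : TestForm n k →L[ℂ] ℂ where
  toFun φ := ω (𝓕⁻ φ)
  map_add' φ ψ := by rw [FourierTransform.fourierInv_add, map_add]
  map_smul' c φ := by rw [FourierTransform.fourierInv_smul, map_smul]; rfl
  cont := (map_continuous ω).comp (FourierTransform.continuous_fourierInv)

lemma fourierCurrent_fourier (ω : Current n k) (φ : TestForm n k) :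
    fourierCurrent ω (𝓕 φ) = ω φ := by
  change ω (𝓕⁻ (𝓕 φ)) = _
  rw [FourierTransform.fourierInv_fourier_eq]

lemma four_mul_pi_sq_ne_zero : (4 * Real.pi ^ 2 : ℂ) ≠ 0 := by
  simp [Real.pi_ne_zero]

/-- Liouville's theorem for currents: the Fourier transform of `ω` is annihilated by `|x|²`, hence
supported at the origin. -/
lemma exists_polyForm_of_laplacian_eq_zero {ω : Current n k} (hω : laplacian n k ω = 0) :
    ∃ θ : polyForms n k, polyToCurrent n k θ = ω := by
  obtain ⟨s, hs⟩ := exists_vanishing_le_ker (fourierCurrent ω) fun φ => by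
    have h1 := fourier_testLaplacian (𝓕⁻ φ)
    rw [FourierTransform.fourier_fourierInv_eq] at h1
    have h2 : fourierCurrent ω (𝓕 (testLaplacian n k (𝓕⁻ φ))) = 0 := by
      rw [fourierCurrent_fourier]
      exact DFunLike.congr_fun hω (𝓕⁻ φ)
    rw [h1, map_smul] at h2
    exact (smul_eq_zero.1 h2).resolve_left four_mul_pi_sq_ne_zero
  obtain ⟨θ, hθ⟩ := mem_fourierPolyForms_of_vanishing
    (f := (fourierCurrent ω).toLinearMap) (s := s) hs
  refine ⟨θ, ?_⟩
  ext φ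
  rw [← hθ]
  exact fourierCurrent_fourier ω φ

/-- Division by `|x|²` on the Fourier side gives `ω₁` with `θ - Δω₁` a polynomial form `η`; solving
`Δζ = η` among polynomial forms corrects it. -/
lemma laplacian_surjective (hn : 1 ≤ n) : Function.Surjective (laplacian n k) := by
  intro θ
  obtain ⟨W, s, hW⟩ := exists_division (fourierCurrent θ)
  let ω₁ : Current n k := ContinuousLinearMap.toPointwiseConvergenceCLM _ _ _ _
    ((4 * Real.pi ^ 2 : ℂ)⁻¹ • W.comp (FourierTransform.fourierCLM ℂ (TestForm n k)))
  have hω₁ : ∀ φ, laplacian n k ω₁ φ = W (normSqCLM (Form n k) n (𝓕 φ)) := fun φ => by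
    change (4 * Real.pi ^ 2 : ℂ)⁻¹ • W (𝓕 (testLaplacian n k φ)) = _
    rw [fourier_testLaplacian, map_smul, smul_smul, inv_mul_cancel₀ four_mul_pi_sq_ne_zero,
      one_smul]
  obtain ⟨η, hη⟩ := mem_fourierPolyForms_of_vanishing
    (f := (fourierCurrent θ - W.comp (normSqCLM (Form n k) n)).toLinearMap) (s := s)
    fun φ hφ => sub_eq_zero.2 (hW φ hφ)
  obtain ⟨ζ, hζ⟩ := polyLaplacian_surjective hn η
  refine ⟨ω₁ + polyToCurrent n k ζ, ?_⟩
  rw [map_add, laplacian_polyToCurrent, hζ]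
  ext φ
  change laplacian n k ω₁ φ + polyToCurrent n k η φ = θ φ
  rw [hω₁, ← hη]
  change _ + (fourierCurrent θ (𝓕 φ) - W (normSqCLM (Form n k) n (𝓕 φ))) = _
  rw [add_sub_cancel, fourierCurrent_fourier]

lemma harmonicToCurrent_injective : Function.Injective (harmonicToCurrent n k) :=
  polyToCurrent_injective.comp harmonicToPoly_injective

lemma harmonicToCurrent_exact : Function.Exact (harmonicToCurrent n k) (laplacian n k) := by
  intro ω
  constructor
  · intro hω
    obtain ⟨θ, rfl⟩ := exists_polyForm_of_laplacian_eq_zero hω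
    rw [laplacian_polyToCurrent] at hω
    obtain ⟨η, hη⟩ := (harmonicToPoly_exact θ).1
      (polyToCurrent_injective (hω.trans (map_zero _).symm))
    exact ⟨η, congrArg (polyToCurrent n k) hη⟩
  · rintro ⟨η, rfl⟩
    refine (laplacian_polyToCurrent _).trans ?_
    rw [(harmonicToPoly_exact _).2 ⟨η, rfl⟩, map_zero]

end Fourier

/-! ### The identity `Δ = δd + dδ` on forms and on currents. -/

section Hodge

variable {n k : ℕ}

lemma toAlt_wedge_apply (μ : Fin n) (α : Form n k) (v : Fin (k + 1) → E n) :
    (wedge μ α).toAlt v = ∑ i : Fin (k + 1), (-1 : ℤ) ^ (i : ℕ) • (v i μ • α.toAlt (i.removeNth v)) :=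
  (ContinuousAlternatingMap.alternatizeUncurryFin_apply _ v).trans rfl

lemma toAlt_interior_apply (μ : Fin n) (α : Form n (k + 1)) (v : Fin k → E n) :
    (interior μ α).toAlt v = α.toAlt (Matrix.vecCons (e μ) v) := rfl

lemma toAlt_ext {α β : Form n k} (h : ∀ v, α.toAlt v = β.toAlt v) : α = β :=
  ContinuousAlternatingMap.ext h

lemma interior_wedge_zero (μ ν : Fin n) (α : Form n 0) :
    interior μ (wedge ν α) = (if μ = ν then (1 : ℂ) else 0) • α := by
  refine toAlt_ext fun v => ?_
  rw [toAlt_interior_apply, toAlt_wedge_apply]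
  change _ = (if μ = ν then (1 : ℂ) else 0) * α.toAlt v
  rw [Fin.sum_univ_one, Subsingleton.elim (Fin.removeNth 0 (Matrix.vecCons (e μ) v)) v]
  by_cases h : μ = ν
  · subst h; simp [e]
  · simp [e, h, Ne.symm h]

/-- In the expansion of `ι_μ (dx_ν ∧ α)`, the term where `dx_ν` receives `e_μ` gives the right-hand
side. The others have their index shifted by one, hence opposite sign, and cancel `dx_ν ∧ ι_μ α`. -/
lemma interior_wedge_add_wedge_interior (μ ν : Fin n) (α : Form n (k + 1)) :
    interior μ (wedge ν α) + wedge ν (interior μ α) = (if μ = ν then (1 : ℂ) else 0) • α := by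
  refine toAlt_ext fun v => ?_
  change (interior μ (wedge ν α)).toAlt v + (wedge ν (interior μ α)).toAlt v =
    (if μ = ν then (1 : ℂ) else 0) * α.toAlt v
  rw [toAlt_interior_apply, toAlt_wedge_apply, toAlt_wedge_apply, Fin.sum_univ_succ, add_assoc,
    ← Finset.sum_add_distrib, Finset.sum_eq_zero, add_zero]
  · have h0 : Fin.removeNth 0 (Matrix.vecCons (e μ) v) = v := by
      ext i; simp [Fin.removeNth]
    rw [h0]
    by_cases h : μ = ν
    · subst h; simp [e]
    · simp [e, h, Ne.symm h]
  · intro i _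
    have h1 : Fin.removeNth i.succ (Matrix.vecCons (e μ) v) =
        Matrix.vecCons (e μ) (i.removeNth v) := by
      funext j
      refine Fin.cases ?_ (fun j => ?_) j <;> simp [Fin.removeNth]
    rw [h1, toAlt_interior_apply, Matrix.cons_val_succ, Fin.val_succ, pow_succ]
    simp

lemma fourier_injective : Function.Injective fun φ : TestForm n k => 𝓕 φ :=
  Function.LeftInverse.injective (g := fun φ => 𝓕⁻ φ) FourierTransform.fourierInv_fourier_eq

/-- On the Fourier side these are multiplications by coordinates, which commute. -/
lemma testPartial_comm (i j : Fin n) (φ : TestForm n k) :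
    testPartial i (testPartial j φ) = testPartial j (testPartial i φ) := by
  refine fourier_injective ?_
  simp only [fourier_testPartial, map_smul]
  congr 2
  ext x
  simp only [coordCLM_apply]
  exact smul_comm _ _ _

lemma testPartial_postcompCLM {l : ℕ} (L : Form n k →L[ℂ] Form n l) (i : Fin n)
    (φ : TestForm n k) :
    testPartial i (SchwartzMap.postcompCLM L φ) = SchwartzMap.postcompCLM L (testPartial i φ) := by
  ext1 x
  have h : HasFDerivAt (SchwartzMap.postcompCLM L φ) _ x :=
    (L.restrictScalars ℝ).hasFDerivAt.comp x (φ.hasFDerivAt x)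
  change fderiv ℝ (SchwartzMap.postcompCLM L φ) x (e i) = _
  rw [h.fderiv]
  rfl

lemma testD_apply (φ : TestForm n k) :
    testD n k φ = ∑ μ, SchwartzMap.postcompCLM (wedge μ) (testPartial μ φ) := by
  simp [testD, sum_apply]

lemma testDelta_apply (φ : TestForm n (k + 1)) :
    testDelta n k φ = -∑ μ, SchwartzMap.postcompCLM (interior μ) (testPartial μ φ) := by
  simp [testDelta, sum_apply]

lemma testDelta_testD_apply (φ : TestForm n k) (x : E n) :
    testDelta n k (testD n k φ) x =
      -∑ μ, ∑ ν, interior μ (wedge ν (testPartial μ (testPartial ν φ) x)) := by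
  rw [testDelta_apply, testD_apply, neg_apply, sum_apply]
  congr 1
  refine Finset.sum_congr rfl fun μ _ => ?_
  rw [map_sum, map_sum, sum_apply]
  refine Finset.sum_congr rfl fun ν _ => ?_
  rw [testPartial_postcompCLM]
  rfl

/-- The sums are swapped and the derivatives commuted to match `testDelta_testD_apply`, so that the
two expressions add summand by summand. -/
lemma testD_testDelta_apply (φ : TestForm n (k + 1)) (x : E n) :
    testD n k (testDelta n k φ) x =
      -∑ μ : Fin n, ∑ ν, wedge ν (interior μ (testPartial μ (testPartial ν φ) x)) := by
  rw [testDelta_apply, testD_apply, sum_apply]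
  conv_rhs => rw [Finset.sum_comm, ← Finset.sum_neg_distrib]
  refine Finset.sum_congr rfl fun ν _ => ?_
  rw [map_neg, map_neg, neg_apply, map_sum, map_sum, sum_apply]
  congr 1
  refine Finset.sum_congr rfl fun μ _ => ?_
  rw [testPartial_postcompCLM, testPartial_comm]
  rfl

lemma testLaplacian_eq_sum_sum (φ : TestForm n k) (x : E n) :
    testLaplacian n k φ x =
      -∑ μ, ∑ ν, (if μ = ν then (1 : ℂ) else 0) • testPartial μ (testPartial ν φ) x := by
  rw [testLaplacian_apply, neg_apply, sum_apply]
  simp [ite_smul]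

lemma testDelta_testD_zero (φ : TestForm n 0) :
    testDelta n 0 (testD n 0 φ) = testLaplacian n 0 φ := by
  ext1 x
  rw [testDelta_testD_apply, testLaplacian_eq_sum_sum]
  simp only [interior_wedge_zero]

lemma testDelta_testD_add_testD_testDelta (φ : TestForm n (k + 1)) :
    testDelta n (k + 1) (testD n (k + 1) φ) + testD n k (testDelta n k φ) =
      testLaplacian n (k + 1) φ := by
  ext1 x
  rw [add_apply, testDelta_testD_apply, testD_testDelta_apply, testLaplacian_eq_sum_sum, ← neg_add,
    ← Finset.sum_add_distrib]
  simp only [← Finset.sum_add_distrib, interior_wedge_add_wedge_interior]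

/-- Transposition exchanges `d` and `δ` and also reverses composition, so `δd` on currents is the
transpose of `δd` on test forms, and likewise for `dδ`. -/
lemma laplacian_eq (ω : Current n k) : laplacian n k ω = deltaD n k ω + dDelta n k ω := by
  ext φ
  rcases k with _ | k
  · change ω (testLaplacian n 0 φ) = ω (testDelta n 0 (testD n 0 φ)) + 0
    rw [testDelta_testD_zero, add_zero]
  · change ω (testLaplacian n (k + 1) φ) = ω (testDelta n (k + 1) (testD n (k + 1) φ)) +
      ω (testD n k (testDelta n k φ))
    rw [← map_add, testDelta_testD_add_testD_testDelta]

lemma dDelta_mem_exactCurrents (ω : Current n k) : dDelta n k ω ∈ exactCurrents n k := by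
  rcases k with _ | k
  · exact Submodule.zero_mem _
  · exact ⟨delta n k ω, rfl⟩

lemma deltaD_mem_coexactCurrents (ω : Current n k) : deltaD n k ω ∈ coexactCurrents n k :=
  ⟨d n k ω, rfl⟩

end Hodge

end TemperateCurrents

end

open TemperateCurrents in
theorem corollary7p3 (n k : ℕ) (hn : 1 ≤ n) :
    -- `0 → 𝓗(ℝⁿ, Λᵏ) → 𝓟(ℝⁿ, Λᵏ) → 𝓟(ℝⁿ, Λᵏ) → 0` is exact
    (Function.Injective (harmonicToPoly n k) ∧
      Function.Exact (harmonicToPoly n k) (polyLaplacian n k) ∧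
      Function.Surjective (polyLaplacian n k)) ∧
    -- `0 → 𝓗(ℝⁿ, Λᵏ) → 𝓢'(ℝⁿ, Λᵏ) → 𝓢'(ℝⁿ, Λᵏ) → 0` is exact
    (Function.Injective (harmonicToCurrent n k) ∧
      Function.Exact (harmonicToCurrent n k) (laplacian n k) ∧
      Function.Surjective (laplacian n k)) ∧
    -- every temperate current is `Δ ω = δ (d ω) + d (δ ω)`, with `ω` unique up to `𝓗(ℝⁿ, Λᵏ)`
    (∀ θ : Current n k, ∃ ω : Current n k,
      θ = laplacian n k ω ∧ laplacian n k ω = deltaD n k ω + dDelta n k ω ∧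
      ∀ ω' : Current n k, θ = deltaD n k ω' + dDelta n k ω' ↔
        ω' - ω ∈ LinearMap.range (harmonicToCurrent n k)) ∧
    -- in particular it is the sum of an exact and a coexact current
    (∀ θ : Current n k, ∃ α ∈ exactCurrents n k, ∃ β ∈ coexactCurrents n k, θ = α + β) := by
  refine ⟨⟨harmonicToPoly_injective, harmonicToPoly_exact, polyLaplacian_surjective hn⟩,
    ⟨harmonicToCurrent_injective, harmonicToCurrent_exact, laplacian_surjective hn⟩,
    fun θ => ?_, fun θ => ?_⟩
  · obtain ⟨ω, rfl⟩ := laplacian_surjective hn θ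
    refine ⟨ω, rfl, laplacian_eq ω, fun ω' => ?_⟩
    rw [← laplacian_eq, LinearMap.mem_range]
    -- Uniqueness up to harmonic forms is exactness at the middle term, applied to `ω' - ω`.
    refine Iff.trans ?_ (harmonicToCurrent_exact (ω' - ω))
    rw [map_sub, sub_eq_zero, eq_comm]
  · obtain ⟨ω, rfl⟩ := laplacian_surjective hn θ
    exact ⟨_, dDelta_mem_exactCurrents ω, _, deltaD_mem_coexactCurrents ω,
      (laplacian_eq ω).trans (add_comm _ _)⟩
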